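/- There is an absolute constant $c>0$ such that the following holds for all integers $d\ge 1$, $n_0\ge 1$ and $n$ such that $\log_2(n/n_0)$ is a positive integer, and for every probability distribution $\mu$ on $[0,1]^d$ that is absolutely continuous with respect to Lebesgue measure. Draw $n$ data points $p_1,\dots,p_n$ and a query $q$ iid from $\mu$. Build a round-robin $k$-d tree with minimum leaf size $n_0$ on the data: the root has cell $[0,1]^d$ and contains all data points; a node at level $l$ (the root has level $0$) with fewer than $2n_0$ points is a leaf; otherwise, with $j=(l \bmod d)+1$ and $s$ the median of the $j$-th coordinates of its $m$ points (their $\lceil m/2\rceil$-th order statistic), its points and its cell are split between a left child ($x_j\le s$) and a right child ($x_j>s$) at level $l+1$. Let $C(q)$ be the leaf cell containing $q$, and let $\Delta(C)=\sup_{x,y\in C}\|x-y\|_1$ be the $L^1$ diameter of a cell $C$. If $n_0\ge c\log_2 n$, then $$\mathbb{E}\,\Delta(C(q))\le 6d\left(\frac{n_0}{n}\right)^{1/d}.$$ Moreover, let $\hat p$ be the point returned by defeatist search, that is, a data point in the leaf of $q$ that is closest to $q$ in Euclidean distance (with any measurable rule for breaking ties). Almost surely such a point exists, and $\|q-\hat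 p\|_2\le\|q-\hat p\|_1\le\Delta(C(q))$. Consequently $$\mathbb{E}\,\|q-\hat p\|_2\le\mathbb{E}\,\|q-\hat p\|_1\le 6d\left(\frac{n_0}{n}\right)^{1/d}.$$ -/

import Mathlib

open MeasureTheory

noncomputable section

/-- The median of a finite multiset of `m` reals: its `⌈m/2⌉`-th order statistic. The list
`s.sort` is nondecreasing and indexed from `0`, and `⌈m/2⌉ = (m + 1) / 2`. (The value for the
empty multiset is irrelevant.) -/
def multisetMedian (s : Multiset ℝ) : ℝ :=
  (s.sort (· ≤ ·)).getD ((s.card + 1) / 2 - 1) 0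

/-- A `k`-d tree over data points with labels in `ι`. A leaf stores the labels of its points; an
internal node stores its split coordinate `α` and split value `s`, that is, the rule
`x α ≤ s`, and its left (rule true) and right (rule false) subtrees. -/
inductive KdTree (d : ℕ) (ι : Type) : Type
  | leaf (pts : Finset ι) : KdTree d ι
  | node (α : Fin d) (s : ℝ) (left right : KdTree d ι) : KdTree d ι

namespace KdTree

variable {d : ℕ} {ι : Type}

/-- The split value of the point set `S` along the coordinate `α`. -/
def splitValue (x : ι → EuclideanSpace ℝ (Fin d)) (S : Finset ι) (α : Fin d) : ℝ :=
  multisetMedian (S.val.map fun i => x i α)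

/-- The points of `S` for which the rule `x α ≤ s` is true, where `s` is the median. -/
def leftPart (x : ι → EuclideanSpace ℝ (Fin d)) (S : Finset ι) (α : Fin d) : Finset ι :=
  S.filter fun i => x i α ≤ splitValue x S α

/-- The points of `S` for which the rule `x α ≤ s` is false, where `s` is the median. -/
def rightPart (x : ι → EuclideanSpace ℝ (Fin d)) (S : Finset ι) (α : Fin d) : Finset ι :=
  S.filter fun i => ¬ x i α ≤ splitValue x S α

/-- The round-robin median-split `k`-d tree with minimum leaf size `n₀` on the points `x i`,
`i ∈ S`, for a node at level `l`. A set of fewer than `2 * n₀` points is a leaf; otherwise it is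
split at the median along coordinate `l mod d` (coordinates are numbered from `0`).

The two extra conditions, that each side is strictly smaller than `S`, make the recursion
terminate on every input. When `n₀ ≥ 1` and the `α`-th coordinates of the points are pairwise
distinct, they hold automatically. -/
def build [NeZero d] (n₀ : ℕ) (x : ι → EuclideanSpace ℝ (Fin d)) (S : Finset ι) (l : ℕ) :
    KdTree d ι :=
  if _h : 2 * n₀ ≤ S.card ∧ (leftPart x S (Fin.ofNat d l)).card < S.card ∧
      (rightPart x S (Fin.ofNat d l)).card < S.card then
    node (Fin.ofNat d l) (splitValue x S (Fin.ofNat d l))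
      (build n₀ x (leftPart x S (Fin.ofNat d l)) (l + 1))
      (build n₀ x (rightPart x S (Fin.ofNat d l)) (l + 1))
  else leaf S
termination_by S.card
decreasing_by
  · exact _h.2.1
  · exact _h.2.2

/-- The cell of the leaf that the point `q` is routed to, in a tree whose root has cell `R`. -/
def leafCell : KdTree d ι → EuclideanSpace ℝ (Fin d) → Set (EuclideanSpace ℝ (Fin d)) →
    Set (EuclideanSpace ℝ (Fin d))
  | leaf _, _, R => R
  | node α s left right, q, R =>
    if q α ≤ s then left.leafCell q (R ∩ {y | y α ≤ s})
    else right.leafCell q (R ∩ {y | ¬ y α ≤ s})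

/-- The labels of the data points stored in the leaf that `q` is routed to. -/
def leafPoints : KdTree d ι → EuclideanSpace ℝ (Fin d) → Finset ι
  | leaf pts, _ => pts
  | node α s left right, q => if q α ≤ s then left.leafPoints q else right.leafPoints q

/-- Defeatist search for `q` may return the data point with label `i`: it is a point, among those
stored in the leaf that `q` is routed to, that is nearest to `q` in Euclidean distance. -/
def IsDefeatistAnswer (T : KdTree d ι) (x : ι → EuclideanSpace ℝ (Fin d))
    (q : EuclideanSpace ℝ (Fin d)) (i : ι) : Prop :=
  i ∈ T.leafPoints q ∧ ∀ j ∈ T.leafPoints q, dist (x i) q ≤ dist (x j) q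

end KdTree

/-- The cube `[0,1]^d`. -/
def unitCube (d : ℕ) : Set (EuclideanSpace ℝ (Fin d)) :=
  {x | ∀ i, x i ∈ Set.Icc (0 : ℝ) 1}

/-- The `L¹` distance. -/
def l1Dist {d : ℕ} (x y : EuclideanSpace ℝ (Fin d)) : ℝ := ∑ i, |x i - y i|

/-- The `L¹` diameter of a (bounded) set. -/
def l1Diam {d : ℕ} (C : Set (EuclideanSpace ℝ (Fin d))) : ℝ :=
  sSup {r | ∃ x ∈ C, ∃ y ∈ C, r = l1Dist x y}

/-- The `k`-d tree with minimum leaf size `n₀` on the data points `x 0, …, x (n - 1)`. -/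
def kdTree {d n : ℕ} [NeZero d] (n₀ : ℕ) (x : Fin n → EuclideanSpace ℝ (Fin d)) :
    KdTree d (Fin n) :=
  KdTree.build n₀ x Finset.univ 0

/-- The `L¹` diameter of the leaf cell containing `q`, where the root cell is `[0,1]^d`. -/
def leafCellDiam {d n : ℕ} [NeZero d] (n₀ : ℕ) (x : Fin n → EuclideanSpace ℝ (Fin d))
    (q : EuclideanSpace ℝ (Fin d)) : ℝ :=
  l1Diam ((kdTree n₀ x).leafCell q (unitCube d))

/-- The joint law of `n` data points and one query drawn iid from `μ`. -/
def sampleLaw {d : ℕ} (n : ℕ) (μ : Measure (EuclideanSpace ℝ (Fin d))) :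
    Measure ((Fin n → EuclideanSpace ℝ (Fin d)) × EuclideanSpace ℝ (Fin d)) :=
  (Measure.pi fun _ => μ).prod μ

end

/-! The expected `L¹` diameter is the sum over coordinates `j` of the expected side of the leaf cell
along `j`. With `n = n₀ * 2 ^ L`, each of these is shown to be at most `3 * (1/2) ^ (L / d)` with
the floor of `L / d`; removing the floor costs a factor 2.

Fix `j` and give a cell the weight "side along `j` times mass". For fixed data, the expected side is
the total weight of the leaves. A split of another coordinate preserves total weight, because masses
add up. In a split of `j` the sides add up, so the children together weigh at most the parent's side
times the larger of their two masses. A median split makes that mass at most `1/2 + ε` of the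
parent's, outside an event of small probability (`exists_unbalanced_event`: fixed quantiles and
Chebyshev).

The obstacle is dependence. Given the splitting point, the other points of a child are iid from `μ`
restricted to it, but the splitting point itself also belongs to the left child. The induction
`lmarginal_treeSide_le` therefore separates the labels of a node into free ones, `B`, which are
integrated, and frozen ones, `S \ B`, whose positions are arbitrary. Each level freezes at most one
more label, so there are never more than `L`; since `n₀` dominates `L`, they barely move the median.
Conditioning is avoided by leaving probabilities unnormalised: `μ (box b) ^ B.card` is the
probability that the free points lie in the box. One level is `lmarginal_treeSide_le_splitPairs`, a
sum over the splitting label and the set of left labels, with Fubini in each term.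

With `k` levels below the children, a node has at least `n₀ * 2 ^ k` free points. Taking `ε = (3/4)
^ k / 60` makes both `ε` and the failure probability geometrically small in `k`, so the product of
the errors over all levels stays below 3 (`shrinkFactor_mul_le_succ`). -/

open scoped ENNReal

/-! ### The median -/

theorem List.SortedLE.countP_lt_getElem_le {l : List ℝ} (hl : l.SortedLE) {r : ℕ}
    (hr : r < l.length) : l.countP (· < l[r]) ≤ r := by
  have h := l.take_append_drop r
  have h3 : l.countP (· < l[r]) =
      (l.take r).countP (· < l[r]) + (l.drop r).countP (· < l[r]) := by
    rw [← List.countP_append, h]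
  have h4 : (l.drop r).countP (· < l[r]) = 0 := by
    rw [List.countP_eq_zero]
    intro a ha
    obtain ⟨i, hi, rfl⟩ := List.getElem_of_mem ha
    simp only [List.getElem_drop, decide_eq_true_eq, not_lt]
    exact hl.getElem_le_getElem_of_le (by omega)
  have h5 : (l.take r).countP (· < l[r]) ≤ (l.take r).length := List.countP_le_length
  have h6 : (l.take r).length ≤ r := by simp
  omega

theorem List.SortedLE.lt_countP_le_getElem {l : List ℝ} (hl : l.SortedLE) {r : ℕ}
    (hr : r < l.length) : r + 1 ≤ l.countP (· ≤ l[r]) := by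
  have h := l.take_append_drop (r + 1)
  have h2 : (l.take (r + 1)).countP (· ≤ l[r]) = (l.take (r + 1)).length := by
    rw [List.countP_eq_length]
    intro a ha
    obtain ⟨i, hi, rfl⟩ := List.getElem_of_mem ha
    simp only [List.getElem_take, decide_eq_true_eq]
    exact hl.getElem_le_getElem_of_le (by simp at hi; omega)
  calc r + 1 = (l.take (r + 1)).length := by simp; omega
    _ = _ := h2.symm
    _ ≤ _ := (List.take_sublist _ _).countP_le

theorem multisetMedian_spec {M : Multiset ℝ} (hM : M ≠ 0) :
    multisetMedian M ∈ M ∧ M.countP (· < multisetMedian M) < (M.card + 1) / 2 ∧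
      (M.card + 1) / 2 ≤ M.countP (· ≤ multisetMedian M) := by
  have hc : 0 < M.card := Multiset.card_pos.2 hM
  set l := M.sort (· ≤ ·) with hl
  have hlM : (l : Multiset ℝ) = M := Multiset.sort_eq _ _
  have hs : l.SortedLE := by
    have := Multiset.pairwise_sort M (· ≤ ·)
    exact this.sortedLE
  have hlen : l.length = M.card := by simp [hl]
  have hr : (M.card + 1) / 2 - 1 < l.length := by omega
  have hm : multisetMedian M = l[(M.card + 1) / 2 - 1] := by
    rw [multisetMedian, ← hl, List.getD_eq_getElem _ _ hr]
  have h1 := hs.countP_lt_getElem_le hr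
  have h2 := hs.lt_countP_le_getElem hr
  rw [← hm] at h1 h2
  refine ⟨?_, ?_, ?_⟩
  · rw [hm]
    exact (Multiset.mem_sort _).1 (List.getElem_mem hr)
  · have : M.countP (· < multisetMedian M) = l.countP (· < multisetMedian M) := by
      conv_lhs => rw [← hlM, Multiset.coe_countP]
      rw [hlM]
    omega
  · have : M.countP (· ≤ multisetMedian M) = l.countP (· ≤ multisetMedian M) := by
      conv_lhs => rw [← hlM, Multiset.coe_countP]
      rw [hlM]
    omega

namespace KdTree

variable {d : ℕ} {ι : Type}

theorem splitValue_spec (x : ι → EuclideanSpace ℝ (Fin d)) {S : Finset ι} (hS : S.Nonempty)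
    (α : Fin d) :
    (∃ i ∈ S, x i α = splitValue x S α) ∧
      (S.filter fun i => x i α < splitValue x S α).card < (S.card + 1) / 2 ∧
      (S.card + 1) / 2 ≤ (S.filter fun i => x i α ≤ splitValue x S α).card := by
  have h := multisetMedian_spec (M := S.val.map fun i => x i α)
    (by simpa using hS.ne_empty)
  change splitValue x S α ∈ _ ∧ _ ∧ _ at h
  rw [Multiset.countP_map, Multiset.countP_map, Multiset.card_map, Multiset.mem_map] at h
  exact h

/-- Trades the median for a count of points, which is how its measurability is obtained. -/
theorem splitValue_le_iff (x : ι → EuclideanSpace ℝ (Fin d)) {S : Finset ι} (hS : S.Nonempty)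
    (α : Fin d) (t : ℝ) :
    splitValue x S α ≤ t ↔ (S.card + 1) / 2 ≤ (S.filter fun i => x i α ≤ t).card := by
  obtain ⟨-, h1, h2⟩ := splitValue_spec x hS α
  constructor
  · intro h
    exact h2.trans (Finset.card_le_card fun i => by
      simp only [Finset.mem_filter]
      exact fun hi => ⟨hi.1, hi.2.trans h⟩)
  · intro h
    by_contra! hlt
    have : (S.filter fun i => x i α ≤ t).card ≤
        (S.filter fun i => x i α < splitValue x S α).card :=
      Finset.card_le_card fun i => by
        simp only [Finset.mem_filter]
        exact fun hi => ⟨hi.1, hi.2.trans_lt hlt⟩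
    omega

/-- Without ties, only one point sits at the median value, so the left part exceeds the set of
strictly smaller points by at most one. -/
theorem card_leftPart_of_injOn (x : ι → EuclideanSpace ℝ (Fin d)) {S : Finset ι}
    (hS : S.Nonempty) (α : Fin d) (hx : Set.InjOn (fun i => x i α) S) :
    (leftPart x S α).card = (S.card + 1) / 2 := by
  obtain ⟨⟨i₀, hi₀, hs⟩, h1, h2⟩ := splitValue_spec x hS α
  refine le_antisymm ?_ h2
  have : leftPart x S α ⊆ (S.filter fun i => x i α < splitValue x S α).cons i₀ (by simp [hs]) := by
    intro i
    simp only [leftPart, Finset.mem_filter, Finset.mem_cons]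
    rintro ⟨hi, hle⟩
    rcases hle.lt_or_eq with h | h
    · exact Or.inr ⟨hi, h⟩
    · exact Or.inl (hx hi hi₀ (h.trans hs.symm))
  have := Finset.card_le_card this
  rw [Finset.card_cons] at this
  omega

theorem rightPart_eq_sdiff [DecidableEq ι] (x : ι → EuclideanSpace ℝ (Fin d)) (S : Finset ι)
    (α : Fin d) : rightPart x S α = S \ leftPart x S α :=
  Finset.filter_not _ _

theorem leftPart_subset (x : ι → EuclideanSpace ℝ (Fin d)) (S : Finset ι) (α : Fin d) :
    leftPart x S α ⊆ S := Finset.filter_subset _ _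

theorem card_leftPart_add_card_rightPart (x : ι → EuclideanSpace ℝ (Fin d)) (S : Finset ι)
    (α : Fin d) : (leftPart x S α).card + (rightPart x S α).card = S.card :=
  Finset.card_filter_add_card_filter_not _

/-! ### Bounds of the leaf cells -/

/-- The points `y` with `b.1 i < y i ≤ b.2 i` for every coordinate `i`. -/
def box (b : (Fin d → ℝ) × (Fin d → ℝ)) : Set (EuclideanSpace ℝ (Fin d)) :=
  {y | ∀ i, b.1 i < y i ∧ y i ≤ b.2 i}

/-- The points `y` with `b.1 i ≤ y i ≤ b.2 i` for every coordinate `i`. -/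
def closedBox (b : (Fin d → ℝ) × (Fin d → ℝ)) : Set (EuclideanSpace ℝ (Fin d)) :=
  {y | ∀ i, b.1 i ≤ y i ∧ y i ≤ b.2 i}

/-- The bounds of the part of a box on which `y α ≤ s`. -/
noncomputable def leftBounds (b : (Fin d → ℝ) × (Fin d → ℝ)) (α : Fin d) (s : ℝ) :
    (Fin d → ℝ) × (Fin d → ℝ) :=
  (b.1, Function.update b.2 α (min (b.2 α) s))

/-- The bounds of the part of a box on which `s < y α`. -/
noncomputable def rightBounds (b : (Fin d → ℝ) × (Fin d → ℝ)) (α : Fin d) (s : ℝ) :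
    (Fin d → ℝ) × (Fin d → ℝ) :=
  (Function.update b.1 α (max (b.1 α) s), b.2)

theorem mem_box_leftBounds {b : (Fin d → ℝ) × (Fin d → ℝ)} {α : Fin d} {s : ℝ}
    {y : EuclideanSpace ℝ (Fin d)} : y ∈ box (leftBounds b α s) ↔ y ∈ box b ∧ y α ≤ s := by
  simp only [box, leftBounds, Set.mem_ofPred_eq]
  constructor
  · intro h
    refine ⟨fun i => ⟨(h i).1, ?_⟩, ?_⟩
    · have := (h i).2
      rcases eq_or_ne i α with rfl | hi
      · simp at this; exact this.1
      · simpa [hi] using this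
    · have := (h α).2
      simp at this; exact this.2
  · rintro ⟨h, hs⟩ i
    refine ⟨(h i).1, ?_⟩
    rcases eq_or_ne i α with rfl | hi
    · simp [(h i).2, hs]
    · simpa [hi] using (h i).2

theorem mem_box_rightBounds {b : (Fin d → ℝ) × (Fin d → ℝ)} {α : Fin d} {s : ℝ}
    {y : EuclideanSpace ℝ (Fin d)} : y ∈ box (rightBounds b α s) ↔ y ∈ box b ∧ s < y α := by
  simp only [box, rightBounds, Set.mem_ofPred_eq]
  constructor
  · intro h
    refine ⟨fun i => ⟨?_, (h i).2⟩, ?_⟩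
    · have := (h i).1
      rcases eq_or_ne i α with rfl | hi
      · simp at this; exact this.1
      · simpa [hi] using this
    · have := (h α).1
      simp at this; exact this.2
  · rintro ⟨h, hs⟩ i
    refine ⟨?_, (h i).2⟩
    rcases eq_or_ne i α with rfl | hi
    · simp [(h i).1, hs]
    · simpa [hi] using (h i).1

/-- The bounds of the leaf cell that `q` is routed to, in a tree whose root has bounds `b`. -/
noncomputable def leafBounds : KdTree d ι → EuclideanSpace ℝ (Fin d) → (Fin d → ℝ) × (Fin d → ℝ) →
    (Fin d → ℝ) × (Fin d → ℝ)
  | leaf _, _, b => b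
  | node α s left right, q, b =>
    if q α ≤ s then left.leafBounds q (leftBounds b α s)
    else right.leafBounds q (rightBounds b α s)

theorem mem_box_leafBounds (T : KdTree d ι) {q : EuclideanSpace ℝ (Fin d)}
    {b : (Fin d → ℝ) × (Fin d → ℝ)} (hq : q ∈ box b) : q ∈ box (T.leafBounds q b) := by
  induction T generalizing b with
  | leaf => exact hq
  | node α s l r hl hr =>
    unfold leafBounds
    split_ifs with h
    · exact hl (mem_box_leftBounds.2 ⟨hq, h⟩)
    · exact hr (mem_box_rightBounds.2 ⟨hq, not_le.1 h⟩)

/-- The root cell is closed while cuts create half-open faces, so the exact shape of a leaf cell is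
awkward. Being caught between two boxes with the same bounds suffices to determine its diameter. -/
theorem leafCell_between (T : KdTree d ι) (q : EuclideanSpace ℝ (Fin d))
    {b : (Fin d → ℝ) × (Fin d → ℝ)} {R : Set (EuclideanSpace ℝ (Fin d))}
    (h1 : box b ⊆ R) (h2 : R ⊆ closedBox b) :
    box (T.leafBounds q b) ⊆ T.leafCell q R ∧ T.leafCell q R ⊆ closedBox (T.leafBounds q b) := by
  induction T generalizing b R with
  | leaf => exact ⟨h1, h2⟩
  | node α s l r hl hr =>
    unfold leafBounds leafCell
    split_ifs with h
    · refine hl (fun y hy => ?_) ?_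
      · rw [mem_box_leftBounds] at hy
        exact ⟨h1 hy.1, hy.2⟩
      · rintro y ⟨hy, hs⟩ i
        refine ⟨(h2 hy i).1, ?_⟩
        rcases eq_or_ne i α with rfl | hi
        · simpa [leftBounds, (h2 hy i).2] using hs
        · simpa [leftBounds, hi] using (h2 hy i).2
    · refine hr (fun y hy => ?_) ?_
      · rw [mem_box_rightBounds] at hy
        exact ⟨h1 hy.1, not_le.2 hy.2⟩
      · rintro y ⟨hy, hs⟩ i
        refine ⟨?_, (h2 hy i).2⟩
        rcases eq_or_ne i α with rfl | hi
        · simpa [rightBounds, (h2 hy i).1] using (not_le.1 hs).le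
        · simpa [rightBounds, hi] using (h2 hy i).1

theorem l1Dist_le_of_mem_closedBox {b : (Fin d → ℝ) × (Fin d → ℝ)}
    {x y : EuclideanSpace ℝ (Fin d)} (hx : x ∈ closedBox b) (hy : y ∈ closedBox b) :
    l1Dist x y ≤ ∑ i, (b.2 i - b.1 i) :=
  Finset.sum_le_sum fun i _ => abs_sub_le_iff.2
    ⟨by linarith [(hx i).2, (hy i).1], by linarith [(hx i).1, (hy i).2]⟩

theorem l1Diam_of_between {b : (Fin d → ℝ) × (Fin d → ℝ)} {C : Set (EuclideanSpace ℝ (Fin d))}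
    (hb : ∀ i, b.1 i < b.2 i) (h1 : box b ⊆ C) (h2 : C ⊆ closedBox b) :
    l1Diam C = ∑ i, (b.2 i - b.1 i) := by
  have hbdd : BddAbove {r | ∃ x ∈ C, ∃ y ∈ C, r = l1Dist x y} := by
    refine ⟨∑ i, (b.2 i - b.1 i), ?_⟩
    rintro _ ⟨x, hx, y, hy, rfl⟩
    exact l1Dist_le_of_mem_closedBox (h2 hx) (h2 hy)
  have hhi : WithLp.toLp 2 b.2 ∈ box b := fun i => ⟨hb i, le_rfl⟩
  refine le_antisymm (csSup_le ⟨_, _, h1 hhi, _, h1 hhi, rfl⟩ ?_) ?_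
  · rintro _ ⟨x, hx, y, hy, rfl⟩
    exact l1Dist_le_of_mem_closedBox (h2 hx) (h2 hy)
  · have hsum : 0 ≤ ∑ i, (b.2 i - b.1 i) := Finset.sum_nonneg fun i _ => by linarith [hb i]
    set w := ∑ i, (b.2 i - b.1 i)
    by_contra! hlt
    have h0 : 0 ≤ l1Diam C := le_csSup hbdd ⟨_, h1 hhi, _, h1 hhi, by simp [l1Dist]⟩
    have hw : 0 < w := h0.trans_lt hlt
    -- The lower corner need not belong to `C`, so it is approached along the diagonal. This `t`
    -- puts the distance `(1 - t) * w` halfway between `l1Diam C` and `w`.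
    set t := (w - l1Diam C) / (2 * w) with ht
    have ht0 : 0 < t := div_pos (by linarith) (by linarith)
    have htw : t * w = (w - l1Diam C) / 2 := by rw [ht]; field_simp
    have ht1 : t < 1 := by rw [ht, div_lt_one (by linarith)]; linarith
    have hy : WithLp.toLp 2 (fun i => b.1 i + t * (b.2 i - b.1 i)) ∈ box b := fun i => by
      have := hb i
      exact ⟨by simp only; nlinarith, by simp only; nlinarith⟩
    have hle : l1Dist (WithLp.toLp 2 b.2) (WithLp.toLp 2 fun i => b.1 i + t * (b.2 i - b.1 i)) ≤
        l1Diam C := le_csSup hbdd ⟨_, h1 hhi, _, h1 hy, rfl⟩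
    have heq : l1Dist (WithLp.toLp 2 b.2)
        (WithLp.toLp 2 fun i => b.1 i + t * (b.2 i - b.1 i)) = (1 - t) * w := by
      rw [l1Dist, Finset.mul_sum]
      refine Finset.sum_congr rfl fun i _ => ?_
      have := hb i
      simp only
      rw [abs_of_nonneg (by nlinarith)]
      ring
    rw [heq] at hle
    linarith

theorem leafPoints_nonempty [NeZero d] (n₀ : ℕ) (x : ι → EuclideanSpace ℝ (Fin d))
    (q : EuclideanSpace ℝ (Fin d)) (S : Finset ι) (l : ℕ) (hS : S.Nonempty) :
    ((build n₀ x S l).leafPoints q).Nonempty := by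
  induction S, l using build.induct n₀ x with
  | case1 S l h h1 h2 =>
    have hc := card_leftPart_add_card_rightPart x S (Fin.ofNat d l)
    rw [build, dif_pos h, leafPoints]
    split_ifs
    · exact h1 (Finset.card_pos.1 (by omega))
    · exact h2 (Finset.card_pos.1 (by omega))
  | case2 S l h =>
    rw [build, dif_neg h]
    exact hS

theorem mem_leafCell_of_mem_leafPoints [NeZero d] (n₀ : ℕ) (x : ι → EuclideanSpace ℝ (Fin d))
    (q : EuclideanSpace ℝ (Fin d)) (S : Finset ι) (l : ℕ) {R : Set (EuclideanSpace ℝ (Fin d))}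
    (hS : ∀ i ∈ S, x i ∈ R) {i : ι} (hi : i ∈ (build n₀ x S l).leafPoints q) :
    x i ∈ (build n₀ x S l).leafCell q R := by
  induction S, l using build.induct n₀ x generalizing R with
  | case1 S l h h1 h2 =>
    rw [build, dif_pos h] at hi ⊢
    rw [leafPoints] at hi
    rw [leafCell]
    split_ifs at hi ⊢ with hq
    · exact h1 (fun i hi => ⟨hS i (Finset.mem_filter.1 hi).1, (Finset.mem_filter.1 hi).2⟩) hi
    · exact h2 (fun i hi => ⟨hS i (Finset.mem_filter.1 hi).1, (Finset.mem_filter.1 hi).2⟩) hi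
  | case2 S l h =>
    rw [build, dif_neg h] at hi ⊢
    exact hS i hi

theorem mem_leafCell (T : KdTree d ι) {q : EuclideanSpace ℝ (Fin d)}
    {R : Set (EuclideanSpace ℝ (Fin d))} (hq : q ∈ R) : q ∈ T.leafCell q R := by
  induction T generalizing R with
  | leaf => exact hq
  | node α s l r hl hr =>
    unfold leafCell
    split_ifs with h
    · exact hl ⟨hq, h⟩
    · exact hr ⟨hq, h⟩

theorem leafCell_subset (T : KdTree d ι) (q : EuclideanSpace ℝ (Fin d))
    (R : Set (EuclideanSpace ℝ (Fin d))) : T.leafCell q R ⊆ R := by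
  induction T generalizing R with
  | leaf => exact subset_rfl
  | node α s l r hl hr =>
    unfold leafCell
    split_ifs with h
    · exact (hl _).trans Set.inter_subset_left
    · exact (hr _).trans Set.inter_subset_left

theorem exists_isDefeatistAnswer {T : KdTree d ι} {q : EuclideanSpace ℝ (Fin d)}
    (h : (T.leafPoints q).Nonempty) (x : ι → EuclideanSpace ℝ (Fin d)) :
    ∃ i, T.IsDefeatistAnswer x q i :=
  Finset.exists_min_image _ (fun i => dist (x i) q) h
end KdTree

theorem dist_le_l1Dist {d : ℕ} (x y : EuclideanSpace ℝ (Fin d)) : dist x y ≤ l1Dist x y := by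
  have h0 : 0 ≤ l1Dist x y := Finset.sum_nonneg fun i _ => abs_nonneg _
  rw [EuclideanSpace.dist_eq, Real.sqrt_le_left h0, l1Dist]
  simp only [Real.dist_eq]
  exact Finset.sum_sq_le_sq_sum_of_nonneg fun i _ => abs_nonneg _

theorem l1Dist_le_l1Diam {d : ℕ} {C : Set (EuclideanSpace ℝ (Fin d))} (hC : C ⊆ unitCube d)
    {x y : EuclideanSpace ℝ (Fin d)} (hx : x ∈ C) (hy : y ∈ C) : l1Dist x y ≤ l1Diam C := by
  refine le_csSup ⟨∑ _i : Fin d, (1 - 0), ?_⟩ ⟨x, hx, y, hy, rfl⟩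
  rintro _ ⟨x, hx, y, hy, rfl⟩
  exact KdTree.l1Dist_le_of_mem_closedBox (b := (fun _ => 0, fun _ => 1)) (hC hx) (hC hy)

theorem leafCellDiam_eq_sum {d n : ℕ} [NeZero d] (n₀ : ℕ) (x : Fin n → EuclideanSpace ℝ (Fin d))
    {q : EuclideanSpace ℝ (Fin d)} (hq : q ∈ KdTree.box (fun _ => (0 : ℝ), fun _ => (1 : ℝ))) :
    leafCellDiam n₀ x q = ∑ i, (((kdTree n₀ x).leafBounds q (fun _ => 0, fun _ => 1)).2 i -
      ((kdTree n₀ x).leafBounds q (fun _ => 0, fun _ => 1)).1 i) := by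
  obtain ⟨h1, h2⟩ := (kdTree n₀ x).leafCell_between q
    (b := (fun _ => 0, fun _ => 1)) (R := unitCube d)
    (fun y hy i => ⟨(hy i).1.le, (hy i).2⟩) (fun y hy i => hy i)
  have hm := (kdTree n₀ x).mem_box_leafBounds hq
  exact KdTree.l1Diam_of_between (fun i => (hm i).1.trans_le (hm i).2) h1 h2

namespace KdTree

variable {d : ℕ} {ι : Type}

/-! ### Measurability -/

section Measurability

variable {Ω : Type*} [MeasurableSpace Ω]

@[fun_prop]
theorem measurable_coord_apply {X : Ω → ι → EuclideanSpace ℝ (Fin d)} (hX : Measurable X) (i : ι)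
    (α : Fin d) : Measurable fun ω => X ω i α := by
  fun_prop

theorem measurable_splitValue {X : Ω → ι → EuclideanSpace ℝ (Fin d)} (hX : Measurable X)
    (S : Finset ι) (α : Fin d) : Measurable fun ω => splitValue (X ω) S α := by
  rcases S.eq_empty_or_nonempty with rfl | hS
  · simp [splitValue]
  refine measurable_of_Iic fun t => ?_
  have h : Measurable fun ω => (S.filter fun i => X ω i α ≤ t).card := by
    simp only [Finset.card_filter]
    refine Finset.measurable_sum _ fun i _ => Measurable.ite ?_ measurable_const measurable_const
    exact measurableSet_le (measurable_coord_apply hX i α) measurable_const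
  have h2 : (fun ω => splitValue (X ω) S α) ⁻¹' Set.Iic t =
      {ω | (S.card + 1) / 2 ≤ (S.filter fun i => X ω i α ≤ t).card} := by
    ext ω
    exact splitValue_le_iff (X ω) hS α t
  rw [h2]
  exact measurableSet_le measurable_const h

theorem measurableSet_leftPart_eq {X : Ω → ι → EuclideanSpace ℝ (Fin d)} (hX : Measurable X)
    (S T : Finset ι) (α : Fin d) : MeasurableSet {ω | leftPart (X ω) S α = T} := by
  by_cases hT : T ⊆ S
  · have : {ω | leftPart (X ω) S α = T} =
        ⋂ i ∈ S, {ω | X ω i α ≤ splitValue (X ω) S α ↔ i ∈ T} := by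
      ext ω
      simp only [leftPart, Finset.ext_iff, Finset.mem_filter, Set.mem_ofPred_eq, Set.mem_iInter]
      exact ⟨fun h i hi => ⟨fun h1 => (h i).1 ⟨hi, h1⟩, fun h1 => ((h i).2 h1).2⟩,
        fun h i => ⟨fun h1 => (h i h1.1).1 h1.2, fun h1 => ⟨hT h1, (h i (hT h1)).2 h1⟩⟩⟩
    rw [this]
    refine Finset.measurableSet_biInter _ fun i _ => ?_
    have hm := measurableSet_le (measurable_coord_apply hX i α) (measurable_splitValue hX S α)
    by_cases hi : i ∈ T
    · simpa [hi] using hm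
    · have : {ω | X ω i α ≤ splitValue (X ω) S α ↔ i ∈ T} =
          {ω | X ω i α ≤ splitValue (X ω) S α}ᶜ := by
        ext ω
        simp [hi]
      rw [this]
      exact hm.compl
  · convert MeasurableSet.empty
    ext ω
    simp only [Set.mem_ofPred_eq, Set.mem_empty_iff_false, iff_false]
    rintro rfl
    exact hT (leftPart_subset _ _ _)

/-- The left part takes finitely many values, each on a measurable event, so it may be treated as a
fixed set. -/
theorem measurable_comp_leftPart {X : Ω → ι → EuclideanSpace ℝ (Fin d)} (hX : Measurable X)
    (S : Finset ι) (α : Fin d) {β : Type*} [MeasurableSpace β] (f : Finset ι → Ω → β)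
    (hf : ∀ T ⊆ S, Measurable (f T)) : Measurable fun ω => f (leftPart (X ω) S α) ω := by
  intro A hA
  have : (fun ω => f (leftPart (X ω) S α) ω) ⁻¹' A =
      ⋃ T ∈ S.powerset, {ω | leftPart (X ω) S α = T} ∩ f T ⁻¹' A := by
    ext ω
    simp only [Set.mem_preimage, Finset.mem_powerset, Set.mem_iUnion, Set.mem_inter_iff,
      Set.mem_ofPred_eq, exists_prop]
    exact ⟨fun h => ⟨_, leftPart_subset _ _ _, rfl, h⟩, by rintro ⟨T, -, rfl, h⟩; exact h⟩
  rw [this]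
  exact Finset.measurableSet_biUnion _ fun T hT =>
    (measurableSet_leftPart_eq hX S T α).inter (hf T (Finset.mem_powerset.1 hT) hA)

theorem measurable_leftBounds {b : Ω → (Fin d → ℝ) × (Fin d → ℝ)} (hb : Measurable b) (α : Fin d)
    {s : Ω → ℝ} (hs : Measurable s) : Measurable fun ω => leftBounds (b ω) α (s ω) := by
  refine hb.fst.prodMk (measurable_pi_lambda _ fun i => ?_)
  rcases eq_or_ne i α with rfl | hi
  · simpa using (measurable_pi_iff.1 hb.snd i).min hs
  · simpa [hi] using measurable_pi_iff.1 hb.snd i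

theorem measurable_rightBounds {b : Ω → (Fin d → ℝ) × (Fin d → ℝ)} (hb : Measurable b)
    (α : Fin d) {s : Ω → ℝ} (hs : Measurable s) :
    Measurable fun ω => rightBounds (b ω) α (s ω) := by
  refine Measurable.prodMk (measurable_pi_lambda _ fun i => ?_) hb.snd
  rcases eq_or_ne i α with rfl | hi
  · simpa using (measurable_pi_iff.1 hb.fst i).max hs
  · simpa [hi] using measurable_pi_iff.1 hb.fst i

theorem measurable_leafBounds [NeZero d] (n₀ : ℕ) {X : Ω → ι → EuclideanSpace ℝ (Fin d)}
    (hX : Measurable X) {Q : Ω → EuclideanSpace ℝ (Fin d)} (hQ : Measurable Q) (S : Finset ι)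
    (l : ℕ) {b : Ω → (Fin d → ℝ) × (Fin d → ℝ)} (hb : Measurable b) :
    Measurable fun ω => (build n₀ (X ω) S l).leafBounds (Q ω) (b ω) := by
  classical
  induction hc : S.card using Nat.strong_induction_on generalizing S l b with
  | _ m ih =>
    set α := Fin.ofNat d l with hα
    have hs := measurable_splitValue hX S α
    have hq : MeasurableSet {ω | Q ω α ≤ splitValue (X ω) S α} :=
      measurableSet_le (by fun_prop) hs
    -- One unfolding of the tree with the random left part replaced by a fixed `T`, to which the
    -- induction hypothesis applies.
    let f : Finset ι → Ω → (Fin d → ℝ) × (Fin d → ℝ) := fun T ω =>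
      if 2 * n₀ ≤ S.card ∧ T.card < S.card ∧ (S \ T).card < S.card then
        (if Q ω α ≤ splitValue (X ω) S α then
          (build n₀ (X ω) T (l + 1)).leafBounds (Q ω)
            (leftBounds (b ω) α (splitValue (X ω) S α))
        else (build n₀ (X ω) (S \ T) (l + 1)).leafBounds (Q ω)
            (rightBounds (b ω) α (splitValue (X ω) S α))) else b ω
    have hF : (fun ω => (build n₀ (X ω) S l).leafBounds (Q ω) (b ω)) =
        fun ω => f (leftPart (X ω) S α) ω := by
      funext ω
      simp only [f]
      rw [build, ← rightPart_eq_sdiff]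
      split_ifs <;> simp_all [leafBounds]
    rw [hF]
    refine measurable_comp_leftPart hX S α f fun T hT => ?_
    simp only [f]
    by_cases hC : 2 * n₀ ≤ S.card ∧ T.card < S.card ∧ (S \ T).card < S.card
    · simp only [hC, and_self, if_true]
      have h1 := ih _ (hc ▸ hC.2.1) T (l + 1) (measurable_leftBounds hb α hs) rfl
      have h2 := ih _ (hc ▸ hC.2.2) (S \ T) (l + 1) (measurable_rightBounds hb α hs) rfl
      exact Measurable.ite hq h1 h2
    · simpa only [hC, if_false] using hb

theorem measurableSet_mem_box {b : Ω → (Fin d → ℝ) × (Fin d → ℝ)} (hb : Measurable b)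
    {Q : Ω → EuclideanSpace ℝ (Fin d)} (hQ : Measurable Q) :
    MeasurableSet {ω | Q ω ∈ box (b ω)} := by
  have : {ω | Q ω ∈ box (b ω)} =
      ⋂ i, ({ω | (b ω).1 i < Q ω i} ∩ {ω | Q ω i ≤ (b ω).2 i}) := by
    ext ω
    simp [box]
  rw [this]
  refine MeasurableSet.iInter fun i => ?_
  exact (measurableSet_lt (by fun_prop) (by fun_prop)).inter
    (measurableSet_le (by fun_prop) (by fun_prop))

end Measurability

theorem measurableSet_box (b : (Fin d → ℝ) × (Fin d → ℝ)) : MeasurableSet (box b) :=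
  measurableSet_mem_box (Ω := EuclideanSpace ℝ (Fin d)) (b := fun _ => b) measurable_const
    measurable_id

theorem measurableSet_forall_mem_box (B : Finset ι) (b : (Fin d → ℝ) × (Fin d → ℝ)) :
    MeasurableSet {z : ι → EuclideanSpace ℝ (Fin d) | ∀ i ∈ B, z i ∈ box b} := by
  have : {z : ι → EuclideanSpace ℝ (Fin d) | ∀ i ∈ B, z i ∈ box b} =
      ⋂ i ∈ B, (fun z => z i) ⁻¹' box b := by ext; simp
  rw [this]
  exact Finset.measurableSet_biInter _ fun i _ => measurable_pi_apply i (measurableSet_box b)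

/-! ### The total side length of the leaf cells -/

/-- The integral over `q ∈ box b` of the length along the coordinate `j` of the leaf cell that
`q` is routed to. -/
noncomputable def totalSide (μ : Measure (EuclideanSpace ℝ (Fin d))) (j : Fin d) (T : KdTree d ι)
    (b : (Fin d → ℝ) × (Fin d → ℝ)) : ℝ≥0∞ :=
  ∫⁻ q in box b, ENNReal.ofReal ((T.leafBounds q b).2 j - (T.leafBounds q b).1 j) ∂μ

theorem totalSide_leaf (μ : Measure (EuclideanSpace ℝ (Fin d))) (j : Fin d) (S : Finset ι)
    (b : (Fin d → ℝ) × (Fin d → ℝ)) :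
    totalSide μ j (leaf S) b = ENNReal.ofReal (b.2 j - b.1 j) * μ (box b) := by
  simp [totalSide, leafBounds]

theorem box_leftBounds (b : (Fin d → ℝ) × (Fin d → ℝ)) (α : Fin d) (s : ℝ) :
    box (leftBounds b α s) = box b ∩ {y | y α ≤ s} := by
  ext y; exact mem_box_leftBounds

theorem box_rightBounds (b : (Fin d → ℝ) × (Fin d → ℝ)) (α : Fin d) (s : ℝ) :
    box (rightBounds b α s) = box b \ {y | y α ≤ s} := by
  ext y; simp [mem_box_rightBounds]

theorem measurableSet_coord_le (α : Fin d) (s : ℝ) :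
    MeasurableSet {y : EuclideanSpace ℝ (Fin d) | y α ≤ s} :=
  measurableSet_le (by fun_prop) (by fun_prop)

theorem measure_leftBounds_add_rightBounds (μ : Measure (EuclideanSpace ℝ (Fin d)))
    (b : (Fin d → ℝ) × (Fin d → ℝ)) (α : Fin d) (s : ℝ) :
    μ (box (leftBounds b α s)) + μ (box (rightBounds b α s)) = μ (box b) := by
  rw [box_leftBounds, box_rightBounds, measure_inter_add_sdiff _ (measurableSet_coord_le α s)]

theorem totalSide_node (μ : Measure (EuclideanSpace ℝ (Fin d))) (j α : Fin d) (s : ℝ)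
    (T₁ T₂ : KdTree d ι) (b : (Fin d → ℝ) × (Fin d → ℝ)) :
    totalSide μ j (node α s T₁ T₂) b =
      totalSide μ j T₁ (leftBounds b α s) + totalSide μ j T₂ (rightBounds b α s) := by
  rw [totalSide, ← lintegral_inter_add_sdiff _ _ (measurableSet_coord_le α s), totalSide, totalSide,
    ← box_leftBounds, ← box_rightBounds]
  congr 1
  · refine setLIntegral_congr_fun (measurableSet_box _) fun q hq => ?_
    simp only [leafBounds, if_pos (mem_box_leftBounds.1 hq).2]
  · refine setLIntegral_congr_fun (measurableSet_box _) fun q hq => ?_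
    simp only [leafBounds, if_neg (not_le.2 (mem_box_rightBounds.1 hq).2)]

theorem measurable_totalSide [NeZero d] (n₀ : ℕ) {Ω : Type*} [MeasurableSpace Ω]
    (μ : Measure (EuclideanSpace ℝ (Fin d))) [SFinite μ] (j : Fin d)
    {X : Ω → ι → EuclideanSpace ℝ (Fin d)} (hX : Measurable X) (S : Finset ι) (l : ℕ)
    {b : Ω → (Fin d → ℝ) × (Fin d → ℝ)} (hb : Measurable b) :
    Measurable fun ω => totalSide μ j (build n₀ (X ω) S l) (b ω) := by
  have h1 : Measurable fun p : Ω × EuclideanSpace ℝ (Fin d) =>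
      (build n₀ (X p.1) S l).leafBounds p.2 (b p.1) :=
    measurable_leafBounds n₀ (hX.comp measurable_fst) measurable_snd S l (hb.comp measurable_fst)
  have h2 : MeasurableSet {p : Ω × EuclideanSpace ℝ (Fin d) | p.2 ∈ box (b p.1)} :=
    measurableSet_mem_box (hb.comp measurable_fst) measurable_snd
  have h3 : Measurable ({p : Ω × EuclideanSpace ℝ (Fin d) | p.2 ∈ box (b p.1)}.indicator
      fun p => ENNReal.ofReal (((build n₀ (X p.1) S l).leafBounds p.2 (b p.1)).2 j -
        ((build n₀ (X p.1) S l).leafBounds p.2 (b p.1)).1 j)) := by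
    refine Measurable.indicator ?_ h2
    exact ((measurable_pi_iff.1 h1.snd j).sub (measurable_pi_iff.1 h1.fst j)).ennreal_ofReal
  convert h3.lintegral_prod_right' (ν := μ) using 2 with ω
  rw [totalSide, ← lintegral_indicator (measurableSet_box _)]
  rfl

end KdTree

/-! ### Quantiles and concentration of counts -/

theorem exists_cdf_eq (ν : Measure ℝ) [IsProbabilityMeasure ν] (hν : ∀ t, ν {t} = 0) {p : ℝ}
    (hp0 : 0 < p) (hp1 : p < 1) : ∃ t, ν.real (Set.Iic t) = p := by
  have hcont : Continuous (ProbabilityTheory.cdf ν) := by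
    refine continuous_iff_continuousAt.2 fun t => ?_
    rw [(ProbabilityTheory.monotone_cdf ν).continuousAt_iff_leftLim_eq_rightLim,
      StieltjesFunction.rightLim_eq]
    refine le_antisymm ((ProbabilityTheory.monotone_cdf ν).leftLim_le le_rfl) ?_
    have h := (ProbabilityTheory.cdf ν).measure_singleton t
    rw [ProbabilityTheory.measure_cdf, hν] at h
    linarith [ENNReal.ofReal_eq_zero.1 h.symm]
  obtain ⟨a, ha⟩ := ((ProbabilityTheory.tendsto_cdf_atBot ν).eventually_le_const hp0).exists
  obtain ⟨b, hb⟩ := ((ProbabilityTheory.tendsto_cdf_atTop ν).eventually_const_le hp1).exists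
  obtain ⟨t, ht⟩ := mem_range_of_exists_le_of_exists_ge hcont ⟨a, ha⟩ ⟨b, hb⟩
  exact ⟨t, by rw [← ProbabilityTheory.cdf_eq_real, ht]⟩

/-- Chebyshev's inequality; an indicator takes values in `[0, 1]`, so its variance is at most `1/4`.
-/
theorem pi_measure_count_deviation_le {E J : Type*} [MeasurableSpace E] [Fintype J]
    (ν : Measure E) [IsProbabilityMeasure ν] {D : Set E} [DecidablePred (· ∈ D)]
    (hD : MeasurableSet D) {t : ℝ} (ht : 0 < t) :
    Measure.pi (fun _ : J => ν)
      {y | t ≤ |((Finset.univ.filter fun i => y i ∈ D).card : ℝ) - Fintype.card J * ν.real D|} ≤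
      ENNReal.ofReal (Fintype.card J / (4 * t ^ 2)) := by
  set X : E → ℝ := D.indicator 1 with hX
  have hXm : Measurable X := measurable_one.indicator hD
  have hXb : ∀ y, X y ∈ Set.Icc (0 : ℝ) 1 := fun y => by
    by_cases hy : y ∈ D <;> simp [X, hy]
  have hmem : MemLp X 2 ν :=
    MemLp.of_bound hXm.aestronglyMeasurable 1 (ae_of_all _ fun y => by
      rw [Real.norm_of_nonneg (hXb y).1]; exact (hXb y).2)
  have hmem' : ∀ i : J, MemLp (fun y : J → E => X (y i)) 2 (Measure.pi fun _ : J => ν) :=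
    fun i => hmem.comp_measurePreserving (measurePreserving_eval _ i)
  have hint : ∀ i : J, ∫ y : J → E, X (y i) ∂(Measure.pi fun _ : J => ν) = ν.real D := fun i => by
    rw [integral_comp_eval (μ := fun _ : J => ν) (f := X) hXm.aestronglyMeasurable, hX,
      integral_indicator_one hD]
  have hsum : MemLp (∑ i, fun y : J → E => X (y i)) 2 (Measure.pi fun _ : J => ν) :=
    memLp_finsetSum' _ fun i _ => hmem' i
  have hexp : ∫ y, (∑ i, fun y : J → E => X (y i)) y ∂(Measure.pi fun _ : J => ν) =
      Fintype.card J * ν.real D := by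
    simp only [Finset.sum_apply]
    rw [integral_finsetSum _ fun i _ => (hmem' i).integrable (by norm_num)]
    simp [hint]
  have hvar : ProbabilityTheory.variance (∑ i, fun y : J → E => X (y i))
      (Measure.pi fun _ : J => ν) ≤ Fintype.card J / 4 := by
    rw [ProbabilityTheory.variance_sum_pi fun _ => hmem]
    calc _ ≤ ∑ _i : J, ((1 - 0 : ℝ) / 2) ^ 2 := Finset.sum_le_sum fun i _ =>
          ProbabilityTheory.variance_le_sq_of_bounded (ae_of_all _ hXb) hXm.aemeasurable
      _ = _ := by simp; ring
  have h := ProbabilityTheory.meas_ge_le_variance_div_sq hsum ht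
  rw [hexp] at h
  have hset : ∀ y : J → E, (∑ i, fun y : J → E => X (y i)) y =
      ((Finset.univ.filter fun i => y i ∈ D).card : ℝ) := fun y => by
    simp [X, Set.indicator_apply]
  simp only [hset] at h
  refine h.trans (ENNReal.ofReal_le_ofReal ?_)
  rw [← div_div]
  gcongr

section Marginal

variable {E ι : Type*} [MeasurableSpace E] [DecidableEq ι]

/-- A marginal at `x` sees only configurations that agree with `x` off `B`; this is how frozen
coordinates are held constant. -/
theorem lmarginal_mono_of_eqOn_compl (μ : Measure E) (B : Finset ι)
    {f g : (ι → E) → ℝ≥0∞} {x : ι → E} (h : ∀ z, (∀ i ∉ B, z i = x i) → f z ≤ g z) :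
    lmarginal (fun _ => μ) B f x ≤ lmarginal (fun _ => μ) B g x :=
  lintegral_mono fun y => h _ fun i hi => by simp [Function.updateFinset, hi]

theorem lmarginal_indicator_forall_mem (μ : Measure E) [SigmaFinite μ] (B : Finset ι) {D : Set E}
    (hD : MeasurableSet D) (c : ℝ≥0∞) (x : ι → E) :
    lmarginal (fun _ => μ) B ({z | ∀ i ∈ B, z i ∈ D}.indicator fun _ => c) x =
      c * μ D ^ B.card := by
  have : ∀ y : B → E, ({z : ι → E | ∀ i ∈ B, z i ∈ D}.indicator (fun _ => c)
      (Function.updateFinset x B y)) = (Set.univ.pi fun _ : B => D).indicator (fun _ => c) y := by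
    intro y
    refine Set.indicator_eq_indicator ?_ rfl
    simp +contextual [Function.updateFinset]
  simp only [lmarginal, this]
  rw [lintegral_indicator_const (MeasurableSet.univ_pi fun _ => hD), Measure.pi_pi]
  simp

/-- Restricted to configurations with all free points in `R`, the product measure is `μ R ^ B.card`
times the product of conditional laws, so Chebyshev applies with success probability `p`. -/
theorem lmarginal_indicator_count_deviation_le (μ : Measure E) [IsFiniteMeasure μ] (B : Finset ι)
    {R D : Set E} [DecidablePred (· ∈ D)] (hR : MeasurableSet R) (hD : MeasurableSet D)
    (hR0 : μ R ≠ 0) {p t : ℝ} (hp : μ.real (R ∩ D) = p * μ.real R) (ht : 0 < t) (x : ι → E) :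
    lmarginal (fun _ => μ) B ({z | (∀ i ∈ B, z i ∈ R) ∧
      t ≤ |((B.filter fun i => z i ∈ D).card : ℝ) - B.card * p|}.indicator 1) x ≤
      ENNReal.ofReal (B.card / (4 * t ^ 2)) * μ R ^ B.card := by
  have hRt : μ R ≠ ∞ := measure_ne_top _ _
  set ν := ProbabilityTheory.cond μ R with hν
  have : IsProbabilityMeasure ν := ProbabilityTheory.cond_isProbabilityMeasure hR0
  have hνD : ν.real D = p := by
    rw [hν, measureReal_def, ProbabilityTheory.cond_apply hR, ENNReal.toReal_mul,
      ENNReal.toReal_inv, ← measureReal_def, ← measureReal_def, hp]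
    have : μ.real R ≠ 0 := (measureReal_ne_zero_iff hRt).2 hR0
    field_simp
  have hpi : (Measure.pi fun _ : B => μ).restrict (Set.univ.pi fun _ => R) =
      μ R ^ B.card • Measure.pi fun _ : B => ν := by
    rw [Measure.restrict_pi_pi]
    refine (Measure.pi_eq fun s hs => ?_)
    rw [Measure.smul_apply, Measure.pi_pi, smul_eq_mul, ← Fintype.card_coe B, ← Finset.card_univ,
      ← Finset.prod_const, ← Finset.prod_mul_distrib]
    refine Finset.prod_congr rfl fun i _ => ?_
    rw [hν, ProbabilityTheory.cond, Measure.smul_apply, smul_eq_mul, ← mul_assoc,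
      ENNReal.mul_inv_cancel hR0 hRt, one_mul]
  set A : Set (B → E) := {y | t ≤ |((Finset.univ.filter fun i => y i ∈ D).card : ℝ) -
      Fintype.card B * ν.real D|} with hA
  have hcount : ∀ y : B → E, (B.filter fun i => Function.updateFinset x B y i ∈ D).card =
      (Finset.univ.filter fun i => y i ∈ D).card := fun y => by
    rw [← Finset.attach_eq_univ, ← Finset.card_map (Function.Embedding.subtype _)]
    congr 1
    ext i
    simp only [Finset.mem_filter, Finset.mem_map, Finset.mem_attach, true_and,
      Function.Embedding.subtype_apply, Subtype.exists, exists_and_right, exists_eq_right]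
    constructor
    · rintro ⟨hi, h⟩
      exact ⟨hi, by simpa [Function.updateFinset, hi] using h⟩
    · rintro ⟨hi, h⟩
      exact ⟨hi, by simpa [Function.updateFinset, hi] using h⟩
  have hind : ∀ y : B → E, ({z : ι → E | (∀ i ∈ B, z i ∈ R) ∧
      t ≤ |((B.filter fun i => z i ∈ D).card : ℝ) - B.card * p|}.indicator 1
      (Function.updateFinset x B y) : ℝ≥0∞) =
      (Set.univ.pi fun _ : B => R).indicator (A.indicator 1) y := by
    intro y
    rw [Set.indicator_indicator]
    refine Set.indicator_eq_indicator ?_ rfl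
    simp only [Set.mem_ofPred_eq, Set.mem_inter_iff, Set.mem_pi, Set.mem_univ, true_imp_iff, hA,
      hcount, hνD, Fintype.card_coe]
    refine and_congr_left fun _ => ?_
    simp +contextual [Function.updateFinset]
  have hAm : MeasurableSet A := by
    refine measurableSet_le measurable_const (Measurable.abs ?_)
    refine Measurable.sub ?_ measurable_const
    simp only [Finset.card_filter, Nat.cast_sum]
    refine Finset.measurable_sum _ fun i _ => ?_
    refine (measurable_from_top (f := fun n : ℕ => (n : ℝ))).comp ?_
    exact Measurable.ite ((measurable_pi_apply i) hD) measurable_const measurable_const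
  simp only [lmarginal, hind]
  rw [lintegral_indicator (MeasurableSet.univ_pi fun _ => hR), hpi, lintegral_smul_measure,
    lintegral_indicator_one hAm, smul_eq_mul, mul_comm]
  gcongr
  simpa only [hA, Fintype.card_coe] using pi_measure_count_deviation_le (J := B) ν hD ht

end Marginal

namespace KdTree

variable {d : ℕ} {ι : Type} [DecidableEq ι]

/-! ### Balance of a median split -/

theorem exists_quantile {μ : Measure (EuclideanSpace ℝ (Fin d))} [IsProbabilityMeasure μ]
    (hμ : ∀ (α : Fin d) (t : ℝ), μ {y | y α = t} = 0) (α : Fin d)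
    {b : (Fin d → ℝ) × (Fin d → ℝ)} (hb : μ (box b) ≠ 0) {p : ℝ} (hp0 : 0 < p) (hp1 : p < 1) :
    ∃ t, μ.real (box (leftBounds b α t)) = p * μ.real (box b) := by
  have hm : Measurable fun y : EuclideanSpace ℝ (Fin d) => y α := by fun_prop
  set ν := (ProbabilityTheory.cond μ (box b)).map fun y => y α with hν
  have : IsProbabilityMeasure (ProbabilityTheory.cond μ (box b)) :=
    ProbabilityTheory.cond_isProbabilityMeasure hb
  have : IsProbabilityMeasure ν := Measure.isProbabilityMeasure_map hm.aemeasurable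
  obtain ⟨t, ht⟩ := exists_cdf_eq ν (fun t => by
    rw [hν, Measure.map_apply hm (measurableSet_singleton t)]
    exact ProbabilityTheory.cond_absolutelyContinuous (hμ α t)) hp0 hp1
  refine ⟨t, ?_⟩
  have hb0 : μ.real (box b) ≠ 0 := (measureReal_ne_zero_iff (measure_ne_top _ _)).2 hb
  rw [measureReal_def, hν, Measure.map_apply hm measurableSet_Iic,
    ProbabilityTheory.cond_apply (measurableSet_box b), ENNReal.toReal_mul, ENNReal.toReal_inv,
    ← measureReal_def, ← measureReal_def] at ht
  rw [box_leftBounds, ← ht]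
  change _ = (μ.real (box b))⁻¹ * μ.real (box b ∩ {y | y α ≤ t}) * μ.real (box b)
  field_simp

theorem box_leftBounds_mono (b : (Fin d → ℝ) × (Fin d → ℝ)) (α : Fin d) {s t : ℝ} (h : s ≤ t) :
    box (leftBounds b α s) ⊆ box (leftBounds b α t) := fun y hy => by
  rw [mem_box_leftBounds] at hy ⊢
  exact ⟨hy.1, hy.2.trans h⟩

-- The split value is random and depends on the frozen points, but no uniform bound over thresholds
-- is needed: it is compared with two deterministic quantiles. A split that is too heavy on one side
-- forces the number of free points below one of these quantiles to deviate, and `A` is the union of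
-- the two deviation events. Hence `A` depends only on the free points and works for every
-- admissible `s`.
open scoped Classical in
theorem exists_unbalanced_event {μ : Measure (EuclideanSpace ℝ (Fin d))} [IsProbabilityMeasure μ]
    (hμ : ∀ (α : Fin d) (t : ℝ), μ {y | y α = t} = 0) (α : Fin d)
    (b : (Fin d → ℝ) × (Fin d → ℝ)) {B S : Finset ι} (hBS : B ⊆ S) {h : ℕ}
    (hS : S.card = 2 * h) {ε : ℝ} (hε0 : 0 < ε) (hε1 : ε < 1 / 2) (hB : 0 < B.card)
    (hl : ((S \ B).card : ℝ) ≤ B.card * ε) :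
    ∃ A : Set (ι → EuclideanSpace ℝ (Fin d)), MeasurableSet A ∧
      (∀ x, lmarginal (fun _ => μ) B (A.indicator 1) x ≤
        ENNReal.ofReal (2 / (B.card * ε ^ 2)) * μ (box b) ^ B.card) ∧
      ∀ z s, (∀ i ∈ S, z i ∈ box b) → (S.filter fun i => z i α ≤ s).card = h → z ∉ A →
        max (μ (box (leftBounds b α s))) (μ (box (rightBounds b α s))) ≤
          ENNReal.ofReal (1 / 2 + ε) * μ (box b) := by
  by_cases hb : μ (box b) = 0
  · refine ⟨∅, MeasurableSet.empty, fun x => by simp [lmarginal], fun z s _ _ _ => ?_⟩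
    have := measure_leftBounds_add_rightBounds μ b α s
    rw [hb, add_eq_zero] at this
    simp [this]
  have hN : (0 : ℝ) < B.card := by exact_mod_cast hB
  -- An imbalance gives a deviation of at least `B.card * ε` less half the number of frozen points,
  -- and `hl` bounds that loss by `B.card * ε / 2`.
  set t : ℝ := B.card * ε / 2 with ht
  have ht0 : 0 < t := by positivity
  obtain ⟨u, hu⟩ := exists_quantile hμ α hb (p := 1 / 2 + ε) (by linarith) (by linarith)
  obtain ⟨v, hv⟩ := exists_quantile hμ α hb (p := 1 / 2 - ε) (by linarith) (by linarith)
  let A : ℝ → ℝ → Set (ι → EuclideanSpace ℝ (Fin d)) := fun w p =>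
    {z | (∀ i ∈ B, z i ∈ box b) ∧
      t ≤ |((B.filter fun i => z i ∈ {y : EuclideanSpace ℝ (Fin d) | y α ≤ w}).card : ℝ) -
        B.card * p|}
  have hA : ∀ w p, MeasurableSet (A w p) := fun w p => by
    have h2 : MeasurableSet {z : ι → EuclideanSpace ℝ (Fin d) |
        t ≤ |((B.filter fun i => z i ∈ {y : EuclideanSpace ℝ (Fin d) | y α ≤ w}).card : ℝ) -
          B.card * p|} := by
      refine measurableSet_le measurable_const (Measurable.abs ?_)
      refine Measurable.sub ?_ measurable_const
      simp only [Finset.card_filter, Nat.cast_sum]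
      refine Finset.measurable_sum _ fun i _ => ?_
      refine (measurable_from_top (f := fun n : ℕ => (n : ℝ))).comp ?_
      exact Measurable.ite ((measurable_pi_apply i) (measurableSet_coord_le α w))
        measurable_const measurable_const
    exact (measurableSet_forall_mem_box B b).inter h2
  have hAle : ∀ w p, μ.real (box (leftBounds b α w)) = p * μ.real (box b) → ∀ x,
      lmarginal (fun _ => μ) B ((A w p).indicator 1) x ≤
        ENNReal.ofReal (1 / (B.card * ε ^ 2)) * μ (box b) ^ B.card := fun w p hw x => by
    rw [box_leftBounds] at hw
    refine (lmarginal_indicator_count_deviation_le μ B (measurableSet_box b)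
      (measurableSet_coord_le α w) hb hw ht0 x).trans_eq ?_
    congr 2
    rw [ht]
    field_simp
    norm_num
  have hcard : (h : ℝ) = (B.card + (S \ B).card) / 2 := by
    have := Finset.card_sdiff_add_card_eq_card hBS
    have : ((S \ B).card : ℝ) + B.card = 2 * h := by exact_mod_cast this.trans hS
    linarith
  have hsdiff : ∀ (z : ι → EuclideanSpace ℝ (Fin d)) w,
      (S.filter fun i => z i α ≤ w).card ≤ (B.filter fun i => z i α ≤ w).card + (S \ B).card :=
    fun z w => by
      refine (Finset.card_le_card fun i hi => ?_).trans (Finset.card_union_le _ _)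
      simp only [Finset.mem_filter, Finset.mem_union, Finset.mem_sdiff] at hi ⊢
      tauto
  refine ⟨A u (1 / 2 + ε) ∪ A v (1 / 2 - ε), (hA _ _).union (hA _ _), fun x => ?_, ?_⟩
  · calc _ ≤ lmarginal (fun _ => μ) B ((A u (1 / 2 + ε)).indicator 1 +
            (A v (1 / 2 - ε)).indicator 1) x := by
          refine lmarginal_mono_of_eqOn_compl μ B fun z _ => ?_
          by_cases h1 : z ∈ A u (1 / 2 + ε) <;> by_cases h2 : z ∈ A v (1 / 2 - ε) <;>
            simp [h1, h2, -one_div]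
      _ = lmarginal (fun _ => μ) B ((A u (1 / 2 + ε)).indicator 1) x +
            lmarginal (fun _ => μ) B ((A v (1 / 2 - ε)).indicator 1) x := by
          simp only [lmarginal, Pi.add_apply]
          exact lintegral_add_left
            ((measurable_one.indicator (hA _ _)).comp measurable_updateFinset) _
      _ ≤ _ := add_le_add (hAle _ _ hu x) (hAle _ _ hv x)
      _ = _ := by
          rw [← add_mul, ← ENNReal.ofReal_add (by positivity) (by positivity)]
          congr 2
          ring
  · intro z s hz hs hzA
    have hadd := congrArg ENNReal.toReal (measure_leftBounds_add_rightBounds μ b α s)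
    rw [ENNReal.toReal_add (measure_ne_top _ _) (measure_ne_top _ _)] at hadd
    simp only [← measureReal_def] at hadd
    have key : ∀ C : Set (EuclideanSpace ℝ (Fin d)), μ.real C ≤ (1 / 2 + ε) * μ.real (box b) →
        μ C ≤ ENNReal.ofReal (1 / 2 + ε) * μ (box b) := fun C hC => by
      rw [← ofReal_measureReal (μ := μ) (s := C), ← ofReal_measureReal (μ := μ) (s := box b),
        ← ENNReal.ofReal_mul (by linarith)]
      exact ENNReal.ofReal_le_ofReal hC
    have hmem : ∀ w p, t ≤ |((B.filter fun i => z i α ≤ w).card : ℝ) - B.card * p| → z ∈ A w p :=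
      fun w p h => ⟨fun i hi => hz i (hBS hi), h⟩
    refine max_le (key _ ?_) (key _ ?_)
    -- Left side too heavy: then `u < s`, so at most `h` free points lie below `u`, too few for its
    -- quantile level. The other case is the mirror image with `v`.
    · by_contra! hlt
      have hus : u < s := by
        by_contra! hle
        have := measureReal_mono (μ := μ) (box_leftBounds_mono b α hle)
        linarith
      refine hzA (Or.inl (hmem _ _ ?_))
      have h1 : (B.filter fun i => z i α ≤ u).card ≤ (S.filter fun i => z i α ≤ s).card :=
        Finset.card_le_card fun i hi => by
          simp only [Finset.mem_filter] at hi ⊢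
          exact ⟨hBS hi.1, hi.2.trans hus.le⟩
      rw [hs] at h1
      have h2 : ((B.filter fun i => z i α ≤ u).card : ℝ) ≤ h := by exact_mod_cast h1
      rw [abs_sub_comm]
      refine le_trans ?_ (le_abs_self _)
      linarith
    · by_contra! hlt
      have hsv : s < v := by
        by_contra! hle
        have := measureReal_mono (μ := μ) (box_leftBounds_mono b α hle)
        linarith
      refine hzA (Or.inr (hmem _ _ ?_))
      have h1 : (S.filter fun i => z i α ≤ s).card ≤ (S.filter fun i => z i α ≤ v).card :=
        Finset.card_le_card fun i hi => by
          simp only [Finset.mem_filter] at hi ⊢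
          exact ⟨hi.1, hi.2.trans hsv.le⟩
      have h2 : (h : ℝ) ≤ (B.filter fun i => z i α ≤ v).card + (S \ B).card := by
        exact_mod_cast (hs ▸ h1).trans (hsdiff z v)
      refine le_trans ?_ (le_abs_self _)
      linarith

/-! ### Decomposition according to the splitting point -/

/-- The configurations in which the points of `S` lie in `box b`, the point `i₀` lies in the
box, and the labels of the points that lie below `i₀` along the coordinate `α` are `T \ {i₀}`,
without ties. -/
def splitEvent (b : (Fin d → ℝ) × (Fin d → ℝ)) (α : Fin d) (S T : Finset ι) (i₀ : ι) :
    Set (ι → EuclideanSpace ℝ (Fin d)) :=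
  {z | z i₀ ∈ box b ∧ (∀ i ∈ T, i ≠ i₀ → z i ∈ box b ∧ z i α < z i₀ α) ∧
    ∀ i ∈ S \ T, z i ∈ box b ∧ z i₀ α < z i α}

theorem measurableSet_splitEvent (b : (Fin d → ℝ) × (Fin d → ℝ)) (α : Fin d) (S T : Finset ι)
    (i₀ : ι) : MeasurableSet (splitEvent b α S T i₀) := by
  have hbox : ∀ i : ι, MeasurableSet {z : ι → EuclideanSpace ℝ (Fin d) | z i ∈ box b} :=
    fun i => measurable_pi_apply i (measurableSet_box b)
  have hlt : ∀ i k : ι, MeasurableSet {z : ι → EuclideanSpace ℝ (Fin d) | z i α < z k α} :=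
    fun i k => measurableSet_lt (by fun_prop) (by fun_prop)
  have : splitEvent b α S T i₀ = {z | z i₀ ∈ box b} ∩
      ((⋂ i ∈ T.erase i₀, ({z | z i ∈ box b} ∩ {z | z i α < z i₀ α})) ∩
        ⋂ i ∈ S \ T, ({z | z i ∈ box b} ∩ {z | z i₀ α < z i α})) := by
    ext z
    simp only [splitEvent, Set.mem_ofPred_eq, Set.mem_inter_iff, Set.mem_iInter, Finset.mem_erase,
      ne_eq, and_imp]
    exact and_congr_right fun _ => and_congr_left fun _ => forall_congr' fun _ => forall_comm
  rw [this]
  exact (hbox _).inter ((Finset.measurableSet_biInter _ fun i _ => (hbox _).inter (hlt _ _)).inter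
    (Finset.measurableSet_biInter _ fun i _ => (hbox _).inter (hlt _ _)))

theorem forall_mem_box_of_mem_splitEvent {b : (Fin d → ℝ) × (Fin d → ℝ)} {α : Fin d}
    {S T : Finset ι} {i₀ : ι} {z : ι → EuclideanSpace ℝ (Fin d)} (hz : z ∈ splitEvent b α S T i₀) :
    ∀ i ∈ S, z i ∈ box b := fun i hi => by
  rcases eq_or_ne i i₀ with rfl | hne
  · exact hz.1
  by_cases hT : i ∈ T
  · exact (hz.2.1 i hT hne).1
  · exact (hz.2.2 i (Finset.mem_sdiff.2 ⟨hi, hT⟩)).1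

theorem filter_le_of_mem_splitEvent {b : (Fin d → ℝ) × (Fin d → ℝ)} {α : Fin d}
    {S T : Finset ι} {i₀ : ι} (hT : T ⊆ S) {z : ι → EuclideanSpace ℝ (Fin d)}
    (hz : z ∈ splitEvent b α S T i₀) : (S.filter fun i => z i α ≤ z i₀ α) = T := by
  ext i
  rw [Finset.mem_filter]
  constructor
  · rintro ⟨hi, hle⟩
    by_contra hiT
    exact absurd (hz.2.2 i (Finset.mem_sdiff.2 ⟨hi, hiT⟩)).2 (not_lt.2 hle)
  · intro hi
    refine ⟨hT hi, ?_⟩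
    rcases eq_or_ne i i₀ with rfl | hne
    · exact le_rfl
    · exact (hz.2.1 i hi hne).2.le

/-- Both `T` and `T'` are initial segments for the order along `α`, hence nested, and equal by
cardinality; the splitting label is the strict maximum of its segment. -/
theorem eq_of_mem_splitEvent {b : (Fin d → ℝ) × (Fin d → ℝ)} {α : Fin d} {S T T' : Finset ι}
    {i₀ i₁ : ι} (hT : T ⊆ S) (hT' : T' ⊆ S) (hcard : T.card = T'.card) (hi₀ : i₀ ∈ T)
    (hi₁ : i₁ ∈ T') {z : ι → EuclideanSpace ℝ (Fin d)} (hz : z ∈ splitEvent b α S T i₀)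
    (hz' : z ∈ splitEvent b α S T' i₁) : i₀ = i₁ ∧ T = T' := by
  have h1 := filter_le_of_mem_splitEvent hT hz
  have h2 := filter_le_of_mem_splitEvent hT' hz'
  have hTT : T = T' := by
    rcases le_total (z i₀ α) (z i₁ α) with h | h
    · refine Finset.eq_of_subset_of_card_le ?_ hcard.ge
      rw [← h1, ← h2]
      exact Finset.monotone_filter_right _ fun i _ hi => le_trans hi h
    · refine (Finset.eq_of_subset_of_card_le ?_ hcard.le).symm
      rw [← h1, ← h2]
      exact Finset.monotone_filter_right _ fun i _ hi => le_trans hi h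
  subst hTT
  refine ⟨?_, rfl⟩
  by_contra hne
  exact lt_asymm (hz.2.1 i₁ hi₁ (Ne.symm hne)).2 (hz'.2.1 i₀ hi₀ hne).2

/-- The pairs of a splitting label and a set of `h` labels that contains it. -/
def splitPairs (S : Finset ι) (h : ℕ) : Finset (ι × Finset ι) :=
  (S ×ˢ S.powersetCard h).filter fun p => p.1 ∈ p.2

theorem mem_splitPairs {S : Finset ι} {h : ℕ} {p : ι × Finset ι} :
    p ∈ splitPairs S h ↔ p.2 ⊆ S ∧ p.2.card = h ∧ p.1 ∈ p.2 := by
  simp only [splitPairs, Finset.mem_filter, Finset.mem_product, Finset.mem_powersetCard]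
  exact ⟨fun h => ⟨h.1.2.1, h.1.2.2, h.2⟩, fun h => ⟨⟨h.1 h.2.2, h.1, h.2.1⟩, h.2.2⟩⟩

/-- The split events are disjoint, so at most one term survives and a pointwise bound on it bounds
the sum. -/
theorem sum_splitPairs_indicator_le {b : (Fin d → ℝ) × (Fin d → ℝ)} {α : Fin d} {S : Finset ι}
    {h : ℕ} {z : ι → EuclideanSpace ℝ (Fin d)} {f : ι × Finset ι → ℝ≥0∞} {M : ℝ≥0∞}
    (hf : ∀ p ∈ splitPairs S h, z ∈ splitEvent b α S p.2 p.1 → f p ≤ M) :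
    ∑ p ∈ splitPairs S h, (splitEvent b α S p.2 p.1).indicator (fun _ => f p) z ≤ M := by
  by_cases hex : ∃ p ∈ splitPairs S h, z ∈ splitEvent b α S p.2 p.1
  · obtain ⟨p, hp, hz⟩ := hex
    rw [Finset.sum_eq_single_of_mem p hp]
    · rw [Set.indicator_of_mem hz]
      exact hf p hp hz
    · intro q hq hne
      refine Set.indicator_of_notMem (fun hz' => hne ?_) _
      rw [mem_splitPairs] at hp hq
      obtain ⟨h1, h2⟩ := eq_of_mem_splitEvent hq.1 hp.1 (hq.2.1.trans hp.2.1.symm) hq.2.2 hp.2.2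
        hz' hz
      exact Prod.ext h1 h2
  · push Not at hex
    rw [Finset.sum_eq_zero fun p hp => Set.indicator_of_notMem (hex p hp) _]
    exact zero_le

end KdTree

section Marginal

variable {E ι : Type*} [MeasurableSpace E] [DecidableEq ι]

theorem lmarginal_fun_add (μ : Measure E) (B : Finset ι) {f g : (ι → E) → ℝ≥0∞}
    (hf : Measurable f) (x : ι → E) :
    lmarginal (fun _ => μ) B (fun z => f z + g z) x =
      lmarginal (fun _ => μ) B f x + lmarginal (fun _ => μ) B g x :=
  lintegral_add_left (hf.comp measurable_updateFinset) _

theorem lmarginal_fun_finsetSum (μ : Measure E) (B : Finset ι) {κ : Type*} (s : Finset κ)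
    {f : κ → (ι → E) → ℝ≥0∞} (hf : ∀ k ∈ s, Measurable (f k)) (x : ι → E) :
    lmarginal (fun _ => μ) B (fun z => ∑ k ∈ s, f k z) x =
      ∑ k ∈ s, lmarginal (fun _ => μ) B (f k) x :=
  lintegral_finsetSum s fun k hk => (hf k hk).comp measurable_updateFinset

theorem lmarginal_fun_mul_const (μ : Measure E) (B : Finset ι) {f : (ι → E) → ℝ≥0∞}
    (hf : Measurable f) (c : ℝ≥0∞) (x : ι → E) :
    lmarginal (fun _ => μ) B (fun z => f z * c) x = lmarginal (fun _ => μ) B f x * c :=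
  lintegral_mul_const c (hf.comp measurable_updateFinset)

end Marginal

/-! ### One level of the recursion, as an inequality between marginal integrals -/

namespace KdTree

variable {d : ℕ} {ι : Type}

/-- The side length of a box along the coordinate `j`. -/
noncomputable def side (j : Fin d) (b : (Fin d → ℝ) × (Fin d → ℝ)) : ℝ≥0∞ :=
  ENNReal.ofReal (b.2 j - b.1 j)

theorem side_leftBounds_of_ne {j α : Fin d} (h : j ≠ α) (b : (Fin d → ℝ) × (Fin d → ℝ)) (s : ℝ) :
    side j (leftBounds b α s) = side j b := by
  simp [side, leftBounds, h]

theorem side_rightBounds_of_ne {j α : Fin d} (h : j ≠ α) (b : (Fin d → ℝ) × (Fin d → ℝ))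
    (s : ℝ) : side j (rightBounds b α s) = side j b := by
  simp [side, rightBounds, h]

theorem side_leftBounds_add_side_rightBounds {j : Fin d} {b : (Fin d → ℝ) × (Fin d → ℝ)} {s : ℝ}
    (h1 : b.1 j < s) (h2 : s ≤ b.2 j) :
    side j (leftBounds b j s) + side j (rightBounds b j s) = side j b := by
  simp only [side, leftBounds, rightBounds, Function.update_self, min_eq_right h2,
    max_eq_right h1.le]
  rw [← ENNReal.ofReal_add (by linarith) (by linarith)]
  congr 1
  ring

theorem measurable_side {Ω : Type*} [MeasurableSpace Ω] (j : Fin d)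
    {b : Ω → (Fin d → ℝ) × (Fin d → ℝ)} (hb : Measurable b) : Measurable fun ω => side j (b ω) :=
  ((measurable_pi_iff.1 hb.snd j).sub (measurable_pi_iff.1 hb.fst j)).ennreal_ofReal

theorem measurable_measure_box {Ω : Type*} [MeasurableSpace Ω]
    (μ : Measure (EuclideanSpace ℝ (Fin d))) [SFinite μ] {b : Ω → (Fin d → ℝ) × (Fin d → ℝ)}
    (hb : Measurable b) : Measurable fun ω => μ (box (b ω)) :=
  measurable_measure_prodMk_left (s := {p : Ω × EuclideanSpace ℝ (Fin d) | p.2 ∈ box (b p.1)})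
    (measurableSet_mem_box (hb.comp measurable_fst) measurable_snd)

/-- The configurations in which no two points share a coordinate. -/
def generic (d : ℕ) (ι : Type) : Set (ι → EuclideanSpace ℝ (Fin d)) :=
  {z | ∀ i i', i ≠ i' → ∀ α, z i α ≠ z i' α}

/-- The total side length of the tree on the points of `S`, on generic configurations whose
points lie in `box b`. -/
noncomputable def treeSide [NeZero d] (n₀ : ℕ) (μ : Measure (EuclideanSpace ℝ (Fin d)))
    (j : Fin d) (S : Finset ι) (l : ℕ) (b : (Fin d → ℝ) × (Fin d → ℝ))
    (z : ι → EuclideanSpace ℝ (Fin d)) : ℝ≥0∞ :=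
  {z : ι → EuclideanSpace ℝ (Fin d) | z ∈ generic d ι ∧ ∀ i ∈ S, z i ∈ box b}.indicator
    (fun z => totalSide μ j (build n₀ z S l) b) z

theorem treeSide_of_mem [NeZero d] {n₀ : ℕ} {μ : Measure (EuclideanSpace ℝ (Fin d))}
    {j : Fin d} {S : Finset ι} {l : ℕ} {b : (Fin d → ℝ) × (Fin d → ℝ)}
    {z : ι → EuclideanSpace ℝ (Fin d)} (hg : z ∈ generic d ι) (hb : ∀ i ∈ S, z i ∈ box b) :
    treeSide n₀ μ j S l b z = totalSide μ j (build n₀ z S l) b :=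
  Set.indicator_of_mem (show z ∈ {z | z ∈ generic d ι ∧ ∀ i ∈ S, z i ∈ box b} from ⟨hg, hb⟩) _

theorem treeSide_of_not [NeZero d] {n₀ : ℕ} {μ : Measure (EuclideanSpace ℝ (Fin d))}
    {j : Fin d} {S : Finset ι} {l : ℕ} {b : (Fin d → ℝ) × (Fin d → ℝ)}
    {z : ι → EuclideanSpace ℝ (Fin d)} (hz : ¬ (z ∈ generic d ι ∧ ∀ i ∈ S, z i ∈ box b)) :
    treeSide n₀ μ j S l b z = 0 :=
  Set.indicator_of_notMem (show z ∉ {z | z ∈ generic d ι ∧ ∀ i ∈ S, z i ∈ box b} from hz) _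

theorem measurableSet_generic [Finite ι] : MeasurableSet (generic d ι) := by
  have : generic d ι = ⋂ i, ⋂ i', ⋂ (_ : i ≠ i'), ⋂ α,
      {z : ι → EuclideanSpace ℝ (Fin d) | z i α = z i' α}ᶜ := by
    ext z
    simp [generic]
  rw [this]
  exact .iInter fun i => .iInter fun i' => .iInter fun _ => .iInter fun α =>
    (measurableSet_eq_fun (by fun_prop) (by fun_prop)).compl

theorem measurable_treeSide [NeZero d] [Finite ι] (n₀ : ℕ)
    (μ : Measure (EuclideanSpace ℝ (Fin d))) [SFinite μ] (j : Fin d) (S : Finset ι) (l : ℕ)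
    {b : (ι → EuclideanSpace ℝ (Fin d)) → (Fin d → ℝ) × (Fin d → ℝ)} (hb : Measurable b) :
    Measurable fun z => treeSide n₀ μ j S l (b z) z := by
  have h1 : MeasurableSet {z : ι → EuclideanSpace ℝ (Fin d) | ∀ i ∈ S, z i ∈ box (b z)} := by
    have : {z : ι → EuclideanSpace ℝ (Fin d) | ∀ i ∈ S, z i ∈ box (b z)} =
        ⋂ i ∈ S, {z | z i ∈ box (b z)} := by ext; simp
    rw [this]
    exact Finset.measurableSet_biInter _ fun i _ => measurableSet_mem_box hb (by fun_prop)
  exact (measurable_totalSide n₀ μ j measurable_id S l hb).indicator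
    (measurableSet_generic.inter h1)

variable [DecidableEq ι]

theorem treeSide_le_sum_splitPairs [NeZero d] {n₀ : ℕ} (μ : Measure (EuclideanSpace ℝ (Fin d)))
    (j : Fin d) {S : Finset ι} {h : ℕ} (hh : 0 < h) (hn : n₀ ≤ h) (hS : S.card = 2 * h) (l : ℕ)
    (b : (Fin d → ℝ) × (Fin d → ℝ)) (z : ι → EuclideanSpace ℝ (Fin d)) :
    treeSide n₀ μ j S l b z ≤ ∑ p ∈ splitPairs S h,
      (splitEvent b (Fin.ofNat d l) S p.2 p.1).indicator (fun z =>
        treeSide n₀ μ j p.2 (l + 1) (leftBounds b (Fin.ofNat d l) (z p.1 (Fin.ofNat d l))) z +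
        treeSide n₀ μ j (S \ p.2) (l + 1)
          (rightBounds b (Fin.ofNat d l) (z p.1 (Fin.ofNat d l))) z) z := by
  set α := Fin.ofNat d l with hα
  by_cases hz : z ∈ generic d ι ∧ ∀ i ∈ S, z i ∈ box b
  swap
  · rw [treeSide_of_not hz]
    exact zero_le
  obtain ⟨hg, hb⟩ := hz
  have hne : S.Nonempty := Finset.card_pos.1 (by omega)
  have hinj : Set.InjOn (fun i => z i α) S := fun i _ i' _ h => by
    by_contra hii
    exact hg i i' hii α h
  obtain ⟨⟨i₀, hi₀, hs⟩, -, -⟩ := splitValue_spec z hne α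
  have hcard : (leftPart z S α).card = h := by
    rw [card_leftPart_of_injOn z hne α hinj]
    omega
  have hcard' := card_leftPart_add_card_rightPart z S α
  have hp : (i₀, leftPart z S α) ∈ splitPairs S h :=
    mem_splitPairs.2 ⟨leftPart_subset _ _ _, hcard, Finset.mem_filter.2 ⟨hi₀, hs.le⟩⟩
  have hE : z ∈ splitEvent b α S (leftPart z S α) i₀ := by
    refine ⟨hb _ hi₀, fun i hi hii => ?_, fun i hi => ?_⟩
    · rw [leftPart, Finset.mem_filter, ← hs] at hi
      exact ⟨hb _ hi.1, lt_of_le_of_ne hi.2 (hg i i₀ hii α)⟩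
    · rw [← rightPart_eq_sdiff, rightPart, Finset.mem_filter, ← hs, not_le] at hi
      exact ⟨hb _ hi.1, hi.2⟩
  refine le_trans ?_ (Finset.single_le_sum (fun _ _ => zero_le) hp)
  have h1 : ∀ i ∈ leftPart z S α, z i ∈ box (leftBounds b α (z i₀ α)) := fun i hi => by
    rw [leftPart, Finset.mem_filter, ← hs] at hi
    exact mem_box_leftBounds.2 ⟨hb _ hi.1, hi.2⟩
  have h2 : ∀ i ∈ S \ leftPart z S α, z i ∈ box (rightBounds b α (z i₀ α)) := fun i hi => by
    rw [← rightPart_eq_sdiff, rightPart, Finset.mem_filter, not_le, ← hs] at hi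
    exact mem_box_rightBounds.2 ⟨hb _ hi.1, hi.2⟩
  rw [Set.indicator_of_mem hE, treeSide_of_mem hg hb, treeSide_of_mem hg h1,
    treeSide_of_mem hg h2, build, ← hα, dif_pos (by omega), totalSide_node, hs,
    rightPart_eq_sdiff]

/-- Fubini with the labels `V` integrated first: since `i₀ ∉ V`, the child's bounds are then
constant. By `hA'`, a nonempty fibre of `A` contains every placement of the `V`-points in `D s`, and
these have exactly the mass `μ (box (c s)) ^ V.card` appearing in `ih`. So that power is reabsorbed
into the indicator of `A`. -/
theorem lmarginal_indicator_treeSide_le [NeZero d] [Finite ι] {n₀ : ℕ}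
    {μ : Measure (EuclideanSpace ℝ (Fin d))} [IsProbabilityMeasure μ] {j α : Fin d}
    {U V B : Finset ι} {i₀ : ι} (hi₀ : i₀ ∉ V) (hVB : V ⊆ B) {l : ℕ}
    {c : ℝ → (Fin d → ℝ) × (Fin d → ℝ)} (hc : Measurable c)
    {D : ℝ → Set (EuclideanSpace ℝ (Fin d))} (hD : ∀ s, MeasurableSet (D s))
    (hμD : ∀ s, μ (D s) = μ (box (c s)))
    {A : Set (ι → EuclideanSpace ℝ (Fin d))} (hA : MeasurableSet A)
    (hA' : ∀ z z', (∀ i ∉ V, z' i = z i) → z ∈ A → (∀ i ∈ V, z' i ∈ D (z i₀ α)) → z' ∈ A)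
    {C : ℝ≥0∞}
    (ih : ∀ b x, lmarginal (fun _ => μ) V (treeSide n₀ μ j U l b) x ≤
      C * (side j b * μ (box b)) * μ (box b) ^ V.card) (x : ι → EuclideanSpace ℝ (Fin d)) :
    lmarginal (fun _ => μ) B (A.indicator fun z => treeSide n₀ μ j U l (c (z i₀ α)) z) x ≤
      lmarginal (fun _ => μ) B
        (A.indicator fun z => C * (side j (c (z i₀ α)) * μ (box (c (z i₀ α))))) x := by
  have hcz : Measurable fun z : ι → EuclideanSpace ℝ (Fin d) => c (z i₀ α) :=
    hc.comp (by fun_prop)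
  have hw : Measurable fun z : ι → EuclideanSpace ℝ (Fin d) =>
      C * (side j (c (z i₀ α)) * μ (box (c (z i₀ α)))) :=
    measurable_const.mul ((measurable_side j hcz).mul (measurable_measure_box μ hcz))
  refine lmarginal_le_of_subset hVB ((measurable_treeSide n₀ μ j U l hcz).indicator hA)
    (hw.indicator hA) (fun z => ?_) x
  by_cases hz : ∃ z' ∈ A, ∀ i ∉ V, z' i = z i
  · obtain ⟨z', hz'A, hz'⟩ := hz
    set s := z i₀ α with hs
    calc _ ≤ lmarginal (fun _ => μ) V (treeSide n₀ μ j U l (c s)) z := by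
          refine lmarginal_mono_of_eqOn_compl μ V fun w hw => ?_
          rw [hs, ← hw i₀ hi₀]
          exact Set.indicator_le_self _ (fun z => treeSide n₀ μ j U l (c (z i₀ α)) z) w
      _ ≤ _ := ih _ _
      _ = lmarginal (fun _ => μ) V ({w | ∀ i ∈ V, w i ∈ D s}.indicator
            fun _ => C * (side j (c s) * μ (box (c s)))) z := by
          rw [lmarginal_indicator_forall_mem μ V (hD s), hμD]
      _ ≤ _ := by
          refine lmarginal_mono_of_eqOn_compl μ V fun w hw => ?_
          by_cases hwD : ∀ i ∈ V, w i ∈ D s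
          · rw [Set.indicator_of_mem (show w ∈ {w | ∀ i ∈ V, w i ∈ D s} from hwD),
              Set.indicator_of_mem, hw i₀ hi₀]
            refine hA' z' w (fun i hi => (hw i hi).trans (hz' i hi).symm) hz'A ?_
            rw [hz' i₀ hi₀]
            exact hwD
          · rw [Set.indicator_of_notMem (show w ∉ {w | ∀ i ∈ V, w i ∈ D s} from hwD)]
            exact zero_le
  · push Not at hz
    refine lmarginal_mono_of_eqOn_compl μ V fun w hw => ?_
    rw [Set.indicator_of_notMem]
    · exact zero_le
    · intro hwA
      obtain ⟨i, hi, hne⟩ := hz w hwA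
      exact hne (hw i hi)

theorem measure_box_inter_lt {μ : Measure (EuclideanSpace ℝ (Fin d))} [IsProbabilityMeasure μ]
    (hμ : ∀ (α : Fin d) (t : ℝ), μ {y | y α = t} = 0) (b : (Fin d → ℝ) × (Fin d → ℝ))
    (α : Fin d) (s : ℝ) : μ (box b ∩ {y | y α < s}) = μ (box (leftBounds b α s)) := by
  rw [box_leftBounds]
  refine le_antisymm (measure_mono fun y hy => ⟨hy.1, le_of_lt (show y α < s from hy.2)⟩) ?_
  calc μ (box b ∩ {y | y α ≤ s}) ≤ μ ((box b ∩ {y | y α < s}) ∪ {y | y α = s}) := by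
        refine measure_mono fun y hy => ?_
        rcases (show y α ≤ s from hy.2).lt_or_eq with h | h
        · exact Or.inl ⟨hy.1, h⟩
        · exact Or.inr h
    _ ≤ μ (box b ∩ {y | y α < s}) + μ {y | y α = s} := measure_union_le _ _
    _ = _ := by rw [hμ, add_zero]

/-- One level of the recursion: the bound for the subtrees turns into an integral over the
splitting point. -/
theorem lmarginal_treeSide_le_splitPairs [NeZero d] [Finite ι] {n₀ : ℕ}
    {μ : Measure (EuclideanSpace ℝ (Fin d))} [IsProbabilityMeasure μ]
    (hμ : ∀ (α : Fin d) (t : ℝ), μ {y | y α = t} = 0) {j : Fin d} {l m h : ℕ} (hh : 0 < h)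
    (hn : n₀ ≤ h) {C : ℝ≥0∞}
    (ih : ∀ (S B : Finset ι) (b : (Fin d → ℝ) × (Fin d → ℝ)) (x : ι → EuclideanSpace ℝ (Fin d)),
      B ⊆ S → S.card = h → (S \ B).card ≤ m + 1 →
      lmarginal (fun _ => μ) B (treeSide n₀ μ j S (l + 1) b) x ≤
        C * (side j b * μ (box b)) * μ (box b) ^ B.card)
    {S B : Finset ι} (hS : S.card = 2 * h) (hm : (S \ B).card ≤ m)
    (b : (Fin d → ℝ) × (Fin d → ℝ)) (x : ι → EuclideanSpace ℝ (Fin d)) :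
    lmarginal (fun _ => μ) B (treeSide n₀ μ j S l b) x ≤
      lmarginal (fun _ => μ) B (fun z => ∑ p ∈ splitPairs S h,
        (splitEvent b (Fin.ofNat d l) S p.2 p.1).indicator (fun _ =>
          C * (side j (leftBounds b (Fin.ofNat d l) (z p.1 (Fin.ofNat d l))) *
              μ (box (leftBounds b (Fin.ofNat d l) (z p.1 (Fin.ofNat d l))))) +
          C * (side j (rightBounds b (Fin.ofNat d l) (z p.1 (Fin.ofNat d l))) *
              μ (box (rightBounds b (Fin.ofNat d l) (z p.1 (Fin.ofNat d l)))))) z) x := by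
  refine (lmarginal_mono (treeSide_le_sum_splitPairs μ j hh hn hS l b) x).trans ?_
  set α := Fin.ofNat d l with hα
  have hL : Measurable fun s : ℝ => leftBounds b α s :=
    measurable_leftBounds measurable_const α measurable_id
  have hR : Measurable fun s : ℝ => rightBounds b α s :=
    measurable_rightBounds measurable_const α measurable_id
  have hz : ∀ i : ι, Measurable fun z : ι → EuclideanSpace ℝ (Fin d) => z i α :=
    fun i => by fun_prop
  have hweight : ∀ {c : ℝ → (Fin d → ℝ) × (Fin d → ℝ)}, Measurable c → ∀ i : ι,
      Measurable fun z : ι → EuclideanSpace ℝ (Fin d) =>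
        C * (side j (c (z i α)) * μ (box (c (z i α)))) := fun hc i =>
    measurable_const.mul ((measurable_side j (hc.comp (hz i))).mul
      (measurable_measure_box μ (hc.comp (hz i))))
  have hE := measurableSet_splitEvent (ι := ι) b α S
  let fL : ι × Finset ι → (ι → EuclideanSpace ℝ (Fin d)) → ℝ≥0∞ := fun p =>
    (splitEvent b α S p.2 p.1).indicator fun z =>
      treeSide n₀ μ j p.2 (l + 1) (leftBounds b α (z p.1 α)) z
  let fR : ι × Finset ι → (ι → EuclideanSpace ℝ (Fin d)) → ℝ≥0∞ := fun p =>
    (splitEvent b α S p.2 p.1).indicator fun z =>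
      treeSide n₀ μ j (S \ p.2) (l + 1) (rightBounds b α (z p.1 α)) z
  let gL : ι × Finset ι → (ι → EuclideanSpace ℝ (Fin d)) → ℝ≥0∞ := fun p =>
    (splitEvent b α S p.2 p.1).indicator fun z =>
      C * (side j (leftBounds b α (z p.1 α)) * μ (box (leftBounds b α (z p.1 α))))
  let gR : ι × Finset ι → (ι → EuclideanSpace ℝ (Fin d)) → ℝ≥0∞ := fun p =>
    (splitEvent b α S p.2 p.1).indicator fun z =>
      C * (side j (rightBounds b α (z p.1 α)) * μ (box (rightBounds b α (z p.1 α))))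
  have hfL : ∀ p, Measurable (fL p) := fun p =>
    (measurable_treeSide n₀ μ j _ _ (hL.comp (hz _))).indicator (hE _ _)
  have hfR : ∀ p, Measurable (fR p) := fun p =>
    (measurable_treeSide n₀ μ j _ _ (hR.comp (hz _))).indicator (hE _ _)
  have hgL : ∀ p, Measurable (gL p) := fun p => (hweight hL _).indicator (hE _ _)
  have hgR : ∀ p, Measurable (gR p) := fun p => (hweight hR _).indicator (hE _ _)
  suffices hp : ∀ p ∈ splitPairs S h,
      lmarginal (fun _ => μ) B (fL p) x ≤ lmarginal (fun _ => μ) B (gL p) x ∧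
      lmarginal (fun _ => μ) B (fR p) x ≤ lmarginal (fun _ => μ) B (gR p) x by
    calc _ = lmarginal (fun _ => μ) B (fun z => ∑ p ∈ splitPairs S h, (fL p z + fR p z)) x := by
          congr 1
          funext z
          refine Finset.sum_congr rfl fun p _ => ?_
          by_cases hzE : z ∈ splitEvent b α S p.2 p.1 <;> simp [fL, fR, hzE]
      _ = ∑ p ∈ splitPairs S h,
            (lmarginal (fun _ => μ) B (fL p) x + lmarginal (fun _ => μ) B (fR p) x) := by
          rw [lmarginal_fun_finsetSum μ B (f := fun p z => fL p z + fR p z) _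
            fun p _ => (hfL p).add (hfR p)]
          exact Finset.sum_congr rfl fun p _ => lmarginal_fun_add μ B (hfL p) x
      _ ≤ ∑ p ∈ splitPairs S h,
            (lmarginal (fun _ => μ) B (gL p) x + lmarginal (fun _ => μ) B (gR p) x) :=
          Finset.sum_le_sum fun p h => add_le_add (hp p h).1 (hp p h).2
      _ = lmarginal (fun _ => μ) B (fun z => ∑ p ∈ splitPairs S h, (gL p z + gR p z)) x := by
          rw [lmarginal_fun_finsetSum μ B (f := fun p z => gL p z + gR p z) _
            fun p _ => (hgL p).add (hgR p)]
          exact (Finset.sum_congr rfl fun p _ => lmarginal_fun_add μ B (hgL p) x).symm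
      _ = _ := by
          congr 1
          funext z
          refine Finset.sum_congr rfl fun p _ => ?_
          by_cases hzE : z ∈ splitEvent b α S p.2 p.1 <;> simp [gL, gR, hzE]
  intro p hp
  obtain ⟨hT, hTc, hi₀⟩ := mem_splitPairs.1 hp
  constructor
  -- The splitting label goes left but its position fixes the cut, so it is frozen there. The split
  -- event asks for strict inequality below the cut, hence this `D`; the hyperplane that it omits is
  -- null.
  · refine lmarginal_indicator_treeSide_le (V := (B ∩ p.2).erase p.1) (c := leftBounds b α)
      (D := fun s => box b ∩ {y | y α < s}) (Finset.notMem_erase _ _)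
      ((Finset.erase_subset _ _).trans Finset.inter_subset_left) hL
      (fun s => (measurableSet_box b).inter (measurableSet_lt (by fun_prop) (by fun_prop)))
      (fun s => measure_box_inter_lt hμ b α s) (hE _ _) ?_ (fun b x => ih _ _ b x ?_ hTc ?_) x
    · rintro z z' hzz ⟨h1, h2, h3⟩ hD
      have h0 : z' p.1 = z p.1 := hzz _ (Finset.notMem_erase _ _)
      refine ⟨by rwa [h0], fun i hi hne => ?_, fun i hi => ?_⟩
      · by_cases hiV : i ∈ (B ∩ p.2).erase p.1
        · rw [h0]
          exact hD i hiV
        · rw [h0, hzz i hiV]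
          exact h2 i hi hne
      · rw [h0, hzz i (by simp [(Finset.mem_sdiff.1 hi).2])]
        exact h3 i hi
    · exact (Finset.erase_subset _ _).trans Finset.inter_subset_right
    -- The only new frozen label is the splitting one, which accounts for `m + 1` in `ih`.
    · refine (Finset.card_le_card (t := insert p.1 (S \ B)) fun i hi => ?_).trans
        ((Finset.card_insert_le _ _).trans (by omega))
      simp only [Finset.mem_sdiff, Finset.mem_erase, Finset.mem_inter, Finset.mem_insert] at hi ⊢
      have := @hT i
      tauto
  · refine lmarginal_indicator_treeSide_le (V := B ∩ (S \ p.2)) (c := rightBounds b α)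
      (D := fun s => box (rightBounds b α s)) (by simp [hi₀])
      Finset.inter_subset_left hR (fun s => measurableSet_box _) (fun s => rfl) (hE _ _) ?_
      (fun b x => ih _ _ b x ?_ ?_ ?_) x
    · rintro z z' hzz ⟨h1, h2, h3⟩ hD
      have h0 : z' p.1 = z p.1 := hzz _ (by simp [hi₀])
      refine ⟨by rwa [h0], fun i hi hne => ?_, fun i hi => ?_⟩
      · rw [h0, hzz i (by simp [hi])]
        exact h2 i hi hne
      · by_cases hiV : i ∈ B ∩ (S \ p.2)
        · rw [h0]
          exact mem_box_rightBounds.1 (hD i hiV)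
        · rw [h0, hzz i hiV]
          exact h3 i hi
    · exact Finset.inter_subset_right
    · have := Finset.card_sdiff_add_card_eq_card hT
      omega
    · refine (Finset.card_le_card (t := S \ B) fun i hi => ?_).trans (by omega)
      simp only [Finset.mem_sdiff, Finset.mem_inter] at hi ⊢
      tauto

end KdTree

/-! ### The shrink factor and the induction on the number of levels -/

namespace KdTree

variable {d : ℕ} {ι : Type}

/-- The number of levels among `l, …, l + k - 1` that split the coordinate `j`. -/
def splitCount [NeZero d] (j : Fin d) (k l : ℕ) : ℕ :=
  Nat.count (fun i => Fin.ofNat d (l + i) = j) k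

theorem splitCount_succ [NeZero d] (j : Fin d) (k l : ℕ) :
    splitCount j (k + 1) l = splitCount j k (l + 1) + if Fin.ofNat d l = j then 1 else 0 := by
  rw [splitCount, Nat.count_succ']
  simp only [add_zero, splitCount, add_assoc, add_comm 1]

theorem div_le_splitCount [NeZero d] (j : Fin d) (k : ℕ) : k / d ≤ splitCount j k 0 := by
  have h : splitCount j k 0 = Nat.count (· ≡ j [MOD d]) k := by
    simp only [splitCount, Nat.count_eq_card_filter_range]
    congr 1
    ext i
    simp only [Finset.mem_filter, zero_add, Fin.ext_iff, Fin.ofNat, Nat.ModEq,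
      Nat.mod_eq_of_lt j.isLt]
  rw [h, Nat.count_modEq_card k (NeZero.pos d)]
  omega

/-- The factor by which the total side length of a tree with `k` levels of splits starting at
level `l` is smaller than the weighted side length of its root. -/
noncomputable def shrinkFactor [NeZero d] (j : Fin d) (k l : ℕ) : ℝ :=
  (1 / 2) ^ splitCount j k l * (3 - 2 * (8 / 9) ^ k)

theorem shrinkFactor_nonneg [NeZero d] (j : Fin d) (k l : ℕ) : 0 ≤ shrinkFactor j k l := by
  have : ((8 : ℝ) / 9) ^ k ≤ 1 := pow_le_one₀ (by norm_num) (by norm_num)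
  exact mul_nonneg (by positivity) (by linarith)

theorem shrinkFactor_le_succ [NeZero d] {j : Fin d} {k l : ℕ} (hj : Fin.ofNat d l ≠ j) :
    shrinkFactor j k (l + 1) ≤ shrinkFactor j (k + 1) l := by
  have h : ((8 : ℝ) / 9) ^ k * (8 / 9) ≤ (8 / 9) ^ k := mul_le_of_le_one_right (by positivity)
    (by norm_num)
  simp only [shrinkFactor, splitCount_succ, hj, if_false, add_zero, pow_succ]
  gcongr

/-- The imbalance and the failure probability are each at most `r / 60` with `r = (8/9) ^ k`, so the
relative loss at this level is `1 + r / 15`. The factor `3 - 2 * r` equals 1 at `k = 0`, remains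
below 3, and grows by `2 * r / 9` per level, just enough to absorb this loss. -/
theorem shrinkFactor_mul_le_succ [NeZero d] (k l : ℕ) {n₀ N : ℝ} (hn : 10 ^ 6 ≤ n₀)
    (hN : n₀ * 2 ^ k ≤ N) :
    shrinkFactor (Fin.ofNat d l) k (l + 1) * (1 / 2 + (1 / 60) * (3 / 4) ^ k +
      2 / (N * ((1 / 60) * (3 / 4) ^ k) ^ 2)) ≤ shrinkFactor (Fin.ofNat d l) (k + 1) l := by
  set r : ℝ := (8 / 9) ^ k with hr
  have hr0 : 0 < r := by positivity
  have hr1 : r ≤ 1 := pow_le_one₀ (by norm_num) (by norm_num)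
  have h1 : ((3 : ℝ) / 4) ^ k ≤ r := pow_le_pow_left₀ (by norm_num) (by norm_num) k
  have h2 : 2 / (N * ((1 / 60) * (3 / 4) ^ k) ^ 2) ≤ r / 60 := by
    -- The rate `8/9` is dictated by `2 * (3/4) ^ 2 = 9/8`, the growth rate of `N * ε ^ 2`.
    have h3 : ((2 : ℝ) ^ k * ((3 / 4) ^ k) ^ 2) * r = 1 := by
      rw [hr, ← pow_mul, mul_comm k 2, pow_mul, ← mul_pow, ← mul_pow]
      norm_num
    have h4 : 10 ^ 6 * ((2 : ℝ) ^ k * ((3 / 4) ^ k) ^ 2) ≤ N * ((3 / 4) ^ k) ^ 2 := by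
      rw [← mul_assoc]
      gcongr
      exact le_trans (by gcongr) hN
    have hN0 : 0 < N := lt_of_lt_of_le (by positivity) hN
    rw [div_le_iff₀ (by positivity)]
    have h5 : 10 ^ 6 * ((2 : ℝ) ^ k * ((3 / 4) ^ k) ^ 2) * r ≤ N * ((3 / 4) ^ k) ^ 2 * r :=
      mul_le_mul_of_nonneg_right h4 hr0.le
    nlinarith
  simp only [shrinkFactor, splitCount_succ, if_true, pow_succ, ← hr]
  have h6 : (3 - 2 * r) * (1 / 2 + (1 / 60) * (3 / 4) ^ k +
      2 / (N * ((1 / 60) * (3 / 4) ^ k) ^ 2)) ≤ (1 / 2) * (3 - 2 * (r * (8 / 9))) := by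
    calc _ ≤ (3 - 2 * r) * (1 / 2 + (1 / 60) * r + r / 60) := by
          have : 0 ≤ 3 - 2 * r := by linarith
          gcongr
      _ ≤ _ := by nlinarith
  calc _ = (1 / 2) ^ splitCount (Fin.ofNat d l) k (l + 1) * ((3 - 2 * r) * (1 / 2 + (1 / 60) *
      (3 / 4) ^ k + 2 / (N * ((1 / 60) * (3 / 4) ^ k) ^ 2))) := by ring
    _ ≤ (1 / 2) ^ splitCount (Fin.ofNat d l) k (l + 1) * ((1 / 2) * (3 - 2 * (r * (8 / 9)))) := by
      gcongr
    _ = _ := by ring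

variable [DecidableEq ι]

/-- The main induction. Uniformity in `x` is what lets labels be frozen, and `hm` is preserved
because each level spends one unit of `k` and freezes at most one label. -/
theorem lmarginal_treeSide_le [NeZero d] [Finite ι] {n₀ L : ℕ}
    {μ : Measure (EuclideanSpace ℝ (Fin d))} [IsProbabilityMeasure μ]
    (hμ : ∀ (α : Fin d) (t : ℝ), μ {y | y α = t} = 0) (hL1 : 1 ≤ L) (hL : 10 ^ 6 * L ≤ n₀)
    (j : Fin d) (k l : ℕ) (S B : Finset ι) (b : (Fin d → ℝ) × (Fin d → ℝ))
    (x : ι → EuclideanSpace ℝ (Fin d)) (hBS : B ⊆ S) (hS : S.card = n₀ * 2 ^ k)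
    (hm : (S \ B).card + k ≤ L) :
    lmarginal (fun _ => μ) B (treeSide n₀ μ j S l b) x ≤
      ENNReal.ofReal (shrinkFactor j k l) * (side j b * μ (box b)) * μ (box b) ^ B.card := by
  induction k generalizing l S B b x with
  | zero =>
    rw [← lmarginal_indicator_forall_mem μ B (measurableSet_box b)]
    refine lmarginal_mono_of_eqOn_compl μ B fun z _ => ?_
    by_cases hz : z ∈ generic d ι ∧ ∀ i ∈ S, z i ∈ box b
    · rw [treeSide_of_mem hz.1 hz.2, build, dif_neg (by omega), totalSide_leaf,
        Set.indicator_of_mem (show z ∈ {z | ∀ i ∈ B, z i ∈ box b} from fun i hi => hz.2 i (hBS hi))]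
      simp only [shrinkFactor, splitCount, Nat.count_zero, pow_zero, side]
      norm_num
    · rw [treeSide_of_not hz]
      exact zero_le
  | succ k ih =>
    set h := n₀ * 2 ^ k with hh
    set N := B.card with hN
    have hk : 1 ≤ 2 ^ k := Nat.one_le_two_pow
    have hn₀h : n₀ ≤ h := Nat.le_mul_of_pos_right _ hk
    have hS2 : S.card = 2 * h := by rw [hS, hh]; ring
    have hNS := Finset.card_sdiff_add_card_eq_card hBS
    have hNh : h ≤ N := by omega
    set C := ENNReal.ofReal (shrinkFactor j k (l + 1)) with hC
    refine (lmarginal_treeSide_le_splitPairs hμ (C := C) (m := (S \ B).card) (by omega) hn₀h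
      (fun T V b x hVT hTc hV => ih (l + 1) T V b x hVT hTc (by omega)) hS2 le_rfl b x).trans ?_
    set α := Fin.ofNat d l with hα
    have hBbox : ∀ {p : ι × Finset ι} {z}, z ∈ splitEvent b α S p.2 p.1 →
        z ∈ {z : ι → EuclideanSpace ℝ (Fin d) | ∀ i ∈ B, z i ∈ box b} := fun hz i hi =>
      forall_mem_box_of_mem_splitEvent hz i (hBS hi)
    by_cases hj : α = j
    · subst hj
      have hhR : (n₀ : ℝ) * 2 ^ k = h := by rw [hh]; push_cast; ring
      have hNR : (h : ℝ) ≤ N := by exact_mod_cast hNh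
      have hLR : (10 : ℝ) ^ 6 * L ≤ n₀ := by exact_mod_cast hL
      have hL1R : (1 : ℝ) ≤ L := by exact_mod_cast hL1
      set ε : ℝ := (1 / 60) * (3 / 4) ^ k with hε
      have hε0 : 0 < ε := by positivity
      have hε1 : ε < 1 / 2 := by
        have : ((3 : ℝ) / 4) ^ k ≤ 1 := pow_le_one₀ (by norm_num) (by norm_num)
        rw [hε]
        linarith
      -- Frozen labels number at most `L`, while `N * ε` is at least `n₀ / 60`, as `2 * (3/4) ≥ 1`.
      have hl : ((S \ B).card : ℝ) ≤ N * ε := by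
        have h1 : ((S \ B).card : ℝ) ≤ L := by exact_mod_cast (show (S \ B).card ≤ L by omega)
        have h2 : (1 : ℝ) ≤ 2 ^ k * (3 / 4) ^ k := by
          rw [← mul_pow]
          exact one_le_pow₀ (by norm_num)
        calc ((S \ B).card : ℝ) ≤ L := h1
          _ ≤ n₀ / 60 * 1 := by linarith
          _ ≤ n₀ / 60 * (2 ^ k * (3 / 4) ^ k) := by gcongr
          _ = (n₀ * 2 ^ k) * ε := by rw [hε]; ring
          _ ≤ N * ε := by rw [hhR]; gcongr
      obtain ⟨A, hAm, hA, hbal⟩ := exists_unbalanced_event hμ α b hBS hS2 hε0 hε1 (by omega) hl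
      set M := C * (side α b * μ (box b)) with hM
      calc _ ≤ lmarginal (fun _ => μ) B (fun z =>
              {z : ι → EuclideanSpace ℝ (Fin d) | ∀ i ∈ B, z i ∈ box b}.indicator
                (fun _ => M * ENNReal.ofReal (1 / 2 + ε)) z + A.indicator 1 z * M) x := by
            refine lmarginal_mono (fun z => ?_) x
            refine sum_splitPairs_indicator_le (f := fun p =>
              C * (side α (leftBounds b α (z p.1 α)) * μ (box (leftBounds b α (z p.1 α)))) +
              C * (side α (rightBounds b α (z p.1 α)) * μ (box (rightBounds b α (z p.1 α)))))
              fun p hp hz => ?_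
            obtain ⟨hT, hTc, hi₀⟩ := mem_splitPairs.1 hp
            have hzb := forall_mem_box_of_mem_splitEvent hz p.1 (hT hi₀) α
            have hside := side_leftBounds_add_side_rightBounds hzb.1 hzb.2
            rw [Set.indicator_of_mem (hBbox hz), ← mul_add]
            set sL := side α (leftBounds b α (z p.1 α))
            set sR := side α (rightBounds b α (z p.1 α))
            set mL := μ (box (leftBounds b α (z p.1 α)))
            set mR := μ (box (rightBounds b α (z p.1 α)))
            -- The sides sum to the parent's, so only the heavier child matters, wherever the cut
            -- falls.
            have hmax : C * (sL * mL + sR * mR) ≤ C * (side α b * max mL mR) := by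
              rw [← hside, add_mul]
              gcongr
              · exact le_max_left _ _
              · exact le_max_right _ _
            refine hmax.trans ?_
            -- On the bad event the heavier child is bounded by the whole parent; off it, by the
            -- fraction `1/2 + ε`.
            by_cases hzA : z ∈ A
            · refine le_trans ?_ le_add_self
              rw [Set.indicator_of_mem hzA, Pi.one_apply, one_mul, hM]
              gcongr
              have := measure_leftBounds_add_rightBounds μ b α (z p.1 α)
              rw [← this]
              exact max_le le_self_add le_add_self
            · refine le_trans ?_ le_self_add
              have hfil := filter_le_of_mem_splitEvent hT hz
              have := hbal z (z p.1 α) (forall_mem_box_of_mem_splitEvent hz)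
                (by convert hTc) hzA
              calc C * (side α b * max mL mR)
                  ≤ C * (side α b * (ENNReal.ofReal (1 / 2 + ε) * μ (box b))) := by gcongr
                _ = _ := by rw [hM]; ring
        _ = M * ENNReal.ofReal (1 / 2 + ε) * μ (box b) ^ N +
              lmarginal (fun _ => μ) B (A.indicator 1) x * M := by
            rw [lmarginal_fun_add μ B (measurable_const.indicator
              (measurableSet_forall_mem_box B b)), lmarginal_indicator_forall_mem μ B
              (measurableSet_box b), lmarginal_fun_mul_const μ B (measurable_one.indicator hAm)]
        _ ≤ M * ENNReal.ofReal (1 / 2 + ε) * μ (box b) ^ N +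
              ENNReal.ofReal (2 / (N * ε ^ 2)) * μ (box b) ^ N * M := by
            gcongr
            exact hA x
        _ = C * ENNReal.ofReal (1 / 2 + ε + 2 / (N * ε ^ 2)) * (side α b * μ (box b)) *
              μ (box b) ^ N := by
            have hadd : ENNReal.ofReal (1 / 2 + ε + 2 / (N * ε ^ 2)) =
                ENNReal.ofReal (1 / 2 + ε) + ENNReal.ofReal (2 / (N * ε ^ 2)) :=
              ENNReal.ofReal_add (by positivity) (by positivity)
            rw [hadd, hM]
            ring
        _ ≤ _ := by
            gcongr
            rw [hC, ← ENNReal.ofReal_mul (shrinkFactor_nonneg _ _ _)]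
            refine ENNReal.ofReal_le_ofReal ?_
            exact shrinkFactor_mul_le_succ k l (n₀ := n₀) (N := N) (by linarith) (hhR ▸ hNR)
    · calc _ ≤ lmarginal (fun _ => μ) B
              ({z : ι → EuclideanSpace ℝ (Fin d) | ∀ i ∈ B, z i ∈ box b}.indicator
                fun _ => C * (side j b * μ (box b))) x := by
            refine lmarginal_mono (fun z => ?_) x
            refine sum_splitPairs_indicator_le (f := fun p =>
              C * (side j (leftBounds b α (z p.1 α)) * μ (box (leftBounds b α (z p.1 α)))) +
              C * (side j (rightBounds b α (z p.1 α)) * μ (box (rightBounds b α (z p.1 α)))))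
              fun p hp hz => ?_
            -- Splitting another coordinate leaves the side alone and the masses add, so no balance
            -- is needed.
            rw [Set.indicator_of_mem (hBbox hz), side_leftBounds_of_ne (Ne.symm hj),
              side_rightBounds_of_ne (Ne.symm hj), ← mul_add, ← mul_add,
              measure_leftBounds_add_rightBounds]
        _ = C * (side j b * μ (box b)) * μ (box b) ^ N :=
            lmarginal_indicator_forall_mem μ B (measurableSet_box b) _ x
        _ ≤ _ := by
            gcongr
            exact ENNReal.ofReal_le_ofReal (shrinkFactor_le_succ hj)

end KdTree

/-! ### From the recursion to a single expected side length -/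

namespace KdTree

variable {d : ℕ} {ι : Type}

/-- The bounds of the half-open unit cube. -/
def unitBounds (d : ℕ) : (Fin d → ℝ) × (Fin d → ℝ) := (fun _ => 0, fun _ => 1)

theorem volume_hyperplane (α : Fin d) (t : ℝ) :
    volume {y : EuclideanSpace ℝ (Fin d) | y α = t} = 0 := by
  have h := (PiLp.volume_preserving_ofLp (Fin d)).measure_preimage
    (s := {f : Fin d → ℝ | f α = t})
    (measurableSet_eq_fun (measurable_pi_apply α) measurable_const).nullMeasurableSet
  have h2 := Measure.pi_hyperplane (fun _ : Fin d => (volume : Measure ℝ)) α t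
  rw [← volume_pi] at h2
  exact h.trans h2

theorem ae_mem_box_unitBounds {μ : Measure (EuclideanSpace ℝ (Fin d))}
    (hμ : ∀ (α : Fin d) (t : ℝ), μ {y | y α = t} = 0) (hcube : μ (unitCube d)ᶜ = 0) :
    ∀ᵐ y ∂μ, y ∈ box (unitBounds d) := by
  have h1 : ∀ᵐ y ∂μ, y ∈ unitCube d := hcube
  have h2 : ∀ᵐ y ∂μ, ∀ i, ¬ y i = 0 := ae_all_iff.2 fun i => by
    rw [ae_iff]
    simpa using hμ i 0
  filter_upwards [h1, h2] with y hy hy0 i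
  exact ⟨lt_of_le_of_ne (hy i).1 (Ne.symm (hy0 i)), (hy i).2⟩

/-- For each pair of labels, integrating one point with the others fixed asks for the mass of a
hyperplane, which is zero. -/
theorem ae_generic [Fintype ι] {μ : Measure (EuclideanSpace ℝ (Fin d))} [IsProbabilityMeasure μ]
    (hμ : ∀ (α : Fin d) (t : ℝ), μ {y | y α = t} = 0) :
    ∀ᵐ z ∂(Measure.pi fun _ : ι => μ), z ∈ generic d ι := by
  classical
  simp only [generic, Set.mem_ofPred_eq, ae_all_iff]
  intro i i' hne α
  have hm : MeasurableSet {z : ι → EuclideanSpace ℝ (Fin d) | z i α = z i' α} :=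
    measurableSet_eq_fun (by fun_prop) (by fun_prop)
  rw [ae_iff]
  simp only [ne_eq, not_not]
  rw [← lintegral_indicator_one hm]
  refine (lintegral_eq_of_lmarginal_eq {i} (g := fun _ => 0) (measurable_one.indicator hm)
    measurable_const ?_).trans lintegral_zero
  rw [lmarginal_singleton, lmarginal_singleton]
  funext z
  have : ∀ y : EuclideanSpace ℝ (Fin d),
      ({z : ι → EuclideanSpace ℝ (Fin d) | z i α = z i' α}.indicator 1 (Function.update z i y) :
        ℝ≥0∞) = {y : EuclideanSpace ℝ (Fin d) | y α = z i' α}.indicator 1 y := fun y => by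
    refine Set.indicator_eq_indicator ?_ rfl
    simp [Function.update_of_ne (Ne.symm hne)]
  simp only [this, lintegral_zero]
  rw [lintegral_indicator_one (measurableSet_eq_fun (by fun_prop) measurable_const), hμ]

/-- At the root every label is free and the box has side and mass one, so the main induction reduces
to its factor. -/
theorem lintegral_leafBounds_le [NeZero d] {n n₀ L : ℕ}
    {μ : Measure (EuclideanSpace ℝ (Fin d))} [IsProbabilityMeasure μ]
    (hμ : ∀ (α : Fin d) (t : ℝ), μ {y | y α = t} = 0) (hcube : μ (unitCube d)ᶜ = 0)
    (hL1 : 1 ≤ L) (hL : 10 ^ 6 * L ≤ n₀) (hn : n = n₀ * 2 ^ L) (j : Fin d) :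
    ∫⁻ ω, side j ((kdTree n₀ ω.1).leafBounds ω.2 (unitBounds d)) ∂(sampleLaw n μ) ≤
      ENNReal.ofReal (shrinkFactor j L 0) := by
  have hbox := ae_mem_box_unitBounds hμ hcube
  have hrestrict : μ.restrict (box (unitBounds d)) = μ := Measure.restrict_eq_self_of_ae_mem hbox
  have hone : μ (box (unitBounds d)) = 1 := by
    rw [← Measure.restrict_apply_univ, hrestrict, measure_univ]
  have hmeas : Measurable fun ω : (Fin n → EuclideanSpace ℝ (Fin d)) × EuclideanSpace ℝ (Fin d) =>
      side j ((kdTree n₀ ω.1).leafBounds ω.2 (unitBounds d)) :=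
    measurable_side j (measurable_leafBounds n₀ measurable_fst measurable_snd _ _
      measurable_const)
  have hmem : ∀ᵐ x ∂(Measure.pi fun _ : Fin n => μ), ∀ i, x i ∈ box (unitBounds d) :=
    ae_all_iff.2 fun i => (measurePreserving_eval (fun _ : Fin n => μ) i).quasiMeasurePreserving.ae
      hbox
  rw [sampleLaw, lintegral_prod _ hmeas.aemeasurable]
  calc _ = ∫⁻ x, treeSide n₀ μ j Finset.univ 0 (unitBounds d) x
          ∂(Measure.pi fun _ : Fin n => μ) := by
        refine lintegral_congr_ae ?_
        filter_upwards [hmem, ae_generic hμ] with x hx hg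
        rw [treeSide_of_mem hg fun i _ => hx i, totalSide, hrestrict]
        rfl
    _ = lmarginal (fun _ => μ) Finset.univ
          (treeSide n₀ μ j Finset.univ 0 (unitBounds d)) (fun _ => 0) :=
        lintegral_eq_lmarginal_univ _
    _ ≤ _ := lmarginal_treeSide_le hμ hL1 hL j L 0 Finset.univ Finset.univ (unitBounds d) _
        subset_rfl (by simp [hn]) (by simp)
    _ = _ := by
        rw [hone]
        simp [side, unitBounds]

theorem shrinkFactor_zero_le [NeZero d] {n n₀ L : ℕ} (hn₀ : 1 ≤ n₀) (hn : n = n₀ * 2 ^ L)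
    (j : Fin d) : shrinkFactor j L 0 ≤ 6 * ((n₀ : ℝ) / (n : ℝ)) ^ (1 / (d : ℝ)) := by
  have hd : (0 : ℝ) < d := by exact_mod_cast NeZero.pos d
  have hratio : (n₀ : ℝ) / n = (1 / 2) ^ L := by
    have : (n₀ : ℝ) ≠ 0 := by positivity
    rw [hn]
    push_cast
    rw [one_div, inv_pow]
    field_simp
  have hr : (0 : ℝ) ≤ (8 / 9) ^ L := by positivity
  rw [hratio, ← Real.rpow_natCast, ← Real.rpow_mul (by norm_num)]
  -- Coordinate `j` is split at least `⌊L / d⌋` times; the missing fraction of a split turns the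
  -- constant 3 into 6.
  have hfloor : (L : ℝ) * (1 / d) ≤ (L / d : ℕ) + 1 := by
    rw [mul_one_div, div_le_iff₀ hd]
    exact_mod_cast (Nat.lt_div_mul_add (NeZero.pos d)).le.trans_eq (by ring)
  calc shrinkFactor j L 0 ≤ (1 / 2) ^ (L / d) * 3 := by
        rw [shrinkFactor]
        refine mul_le_mul ?_ (by linarith) ?_ (by positivity)
        · exact pow_le_pow_of_le_one (by norm_num) (by norm_num) (div_le_splitCount j L)
        · have : ((8 : ℝ) / 9) ^ L ≤ 1 := pow_le_one₀ (by norm_num) (by norm_num)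
          linarith
    _ = 6 * (1 / 2 : ℝ) ^ (((L / d : ℕ) : ℝ) + 1) := by
        rw [Real.rpow_add_one (by norm_num), Real.rpow_natCast]
        ring
    _ ≤ _ := by
        gcongr 6 * ?_
        exact Real.rpow_le_rpow_of_exponent_ge (by norm_num) (by norm_num) hfloor

end KdTree

/-! ### Expected diameter and defeatist search -/

open KdTree

theorem integral_leafCellDiam_le {d : ℕ} [NeZero d] {n n₀ L : ℕ}
    {μ : Measure (EuclideanSpace ℝ (Fin d))} [IsProbabilityMeasure μ]
    (hμ : ∀ (α : Fin d) (t : ℝ), μ {y | y α = t} = 0) (hcube : μ (unitCube d)ᶜ = 0)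
    (hL1 : 1 ≤ L) (hL : 10 ^ 6 * L ≤ n₀) (hn : n = n₀ * 2 ^ L) :
    Integrable (fun ω => leafCellDiam n₀ ω.1 ω.2) (sampleLaw n μ) ∧
      ∫ ω, leafCellDiam n₀ ω.1 ω.2 ∂(sampleLaw n μ) ≤
        6 * (d : ℝ) * ((n₀ : ℝ) / (n : ℝ)) ^ (1 / (d : ℝ)) := by
  set F : (Fin n → EuclideanSpace ℝ (Fin d)) × EuclideanSpace ℝ (Fin d) →
      (Fin d → ℝ) × (Fin d → ℝ) := fun ω => (kdTree n₀ ω.1).leafBounds ω.2 (unitBounds d) with hF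
  have hFm : Measurable F :=
    measurable_leafBounds n₀ measurable_fst measurable_snd _ _ measurable_const
  have hq : ∀ᵐ ω ∂(sampleLaw n μ), ω.2 ∈ box (unitBounds d) :=
    Measure.quasiMeasurePreserving_snd.ae (ae_mem_box_unitBounds hμ hcube)
  have heq : ∀ᵐ ω ∂(sampleLaw n μ),
      leafCellDiam n₀ ω.1 ω.2 = ∑ i, ((F ω).2 i - (F ω).1 i) := by
    filter_upwards [hq] with ω hω
    exact leafCellDiam_eq_sum n₀ ω.1 hω
  have hnn : ∀ᵐ ω ∂(sampleLaw n μ), ∀ i, 0 ≤ (F ω).2 i - (F ω).1 i := by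
    filter_upwards [hq] with ω hω i
    have := mem_box_leafBounds (kdTree n₀ ω.1) hω i
    linarith [this.1, this.2]
  have hm : AEStronglyMeasurable (fun ω => leafCellDiam n₀ ω.1 ω.2) (sampleLaw n μ) := by
    refine AEStronglyMeasurable.congr (f := fun ω => ∑ i, ((F ω).2 i - (F ω).1 i)) ?_
      (heq.mono fun _ h => h.symm)
    refine (Finset.measurable_sum _ fun i _ => ?_).aestronglyMeasurable
    exact (measurable_pi_iff.1 hFm.snd i).sub (measurable_pi_iff.1 hFm.fst i)
  have hnn' : 0 ≤ᵐ[sampleLaw n μ] fun ω => leafCellDiam n₀ ω.1 ω.2 := by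
    filter_upwards [heq, hnn] with ω h1 h2
    rw [h1]
    exact Finset.sum_nonneg fun i _ => h2 i
  have hn₀ : 1 ≤ n₀ := by omega
  have hbound : ∫⁻ ω, ENNReal.ofReal (leafCellDiam n₀ ω.1 ω.2) ∂(sampleLaw n μ) ≤
      ENNReal.ofReal (6 * (d : ℝ) * ((n₀ : ℝ) / (n : ℝ)) ^ (1 / (d : ℝ))) := by
    calc _ = ∫⁻ ω, ∑ i, side i (F ω) ∂(sampleLaw n μ) := by
          refine lintegral_congr_ae ?_
          filter_upwards [heq, hnn] with ω h1 h2
          rw [h1, ENNReal.ofReal_sum_of_nonneg fun i _ => h2 i]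
          rfl
      _ = ∑ i, ∫⁻ ω, side i (F ω) ∂(sampleLaw n μ) :=
          lintegral_finsetSum _ fun i _ => measurable_side i hFm
      _ ≤ ∑ i : Fin d, ENNReal.ofReal (6 * ((n₀ : ℝ) / (n : ℝ)) ^ (1 / (d : ℝ))) :=
          Finset.sum_le_sum fun i _ => (lintegral_leafBounds_le hμ hcube hL1 hL hn i).trans
            (ENNReal.ofReal_le_ofReal (shrinkFactor_zero_le hn₀ hn i))
      _ = _ := by
          rw [← ENNReal.ofReal_sum_of_nonneg fun i _ => by positivity]
          congr 1
          simp
          ring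
  refine ⟨⟨hm, ?_⟩, ?_⟩
  · rw [hasFiniteIntegral_iff_ofReal hnn']
    exact hbound.trans_lt ENNReal.ofReal_lt_top
  · rw [integral_eq_lintegral_of_nonneg_ae hnn' hm]
    exact ENNReal.toReal_le_of_le_ofReal (by positivity) hbound

theorem measurable_eval_of_finite {Ω ι E : Type*} [MeasurableSpace Ω] [MeasurableSpace E]
    [Countable ι] [MeasurableSpace ι] [MeasurableSingletonClass ι] {x : Ω → ι → E}
    (hx : Measurable x) {r : Ω → ι} (hr : Measurable r) : Measurable fun ω => x ω (r ω) :=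
  (measurable_from_prod_countable_right (f := fun p : ι × Ω => x p.2 p.1)
    fun i => measurable_pi_iff.1 hx i).comp (hr.prodMk measurable_id)

theorem integrable_integral_le_of_le {Ω : Type*} [MeasurableSpace Ω] {P : Measure Ω}
    {f g : Ω → ℝ} {c : ℝ} (hg : Integrable g P ∧ ∫ ω, g ω ∂P ≤ c) (hf : AEStronglyMeasurable f P)
    (h0 : ∀ ω, 0 ≤ f ω) (hfg : ∀ᵐ ω ∂P, f ω ≤ g ω) : Integrable f P ∧ ∫ ω, f ω ∂P ≤ c := by
  have hint : Integrable f P := hg.1.mono' hf <| hfg.mono fun ω h => by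
    rwa [Real.norm_of_nonneg (h0 ω)]
  exact ⟨hint, (integral_mono_ae hint hg.1 hfg).trans hg.2⟩

theorem theorem4p5 :
    ∃ c : ℝ, 0 < c ∧
      ∀ (d : ℕ) [NeZero d] (n n₀ L : ℕ)
        (μ : Measure (EuclideanSpace ℝ (Fin d))) [IsProbabilityMeasure μ],
        μ ≪ volume → μ (unitCube d)ᶜ = 0 →
        1 ≤ n₀ → 1 ≤ L → n = n₀ * 2 ^ L →
        c * Real.logb 2 (n : ℝ) ≤ (n₀ : ℝ) →
        -- the expected diameter of the leaf cell of the query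
        (Integrable (fun ω => leafCellDiam n₀ ω.1 ω.2) (sampleLaw n μ) ∧
          ∫ ω, leafCellDiam n₀ ω.1 ω.2 ∂(sampleLaw n μ) ≤
            6 * (d : ℝ) * ((n₀ : ℝ) / (n : ℝ)) ^ (1 / (d : ℝ))) ∧
        -- defeatist search returns a point, and each point that it may return is within
        -- that diameter of the query
        (∀ᵐ ω ∂(sampleLaw n μ),
          (∃ i, (kdTree n₀ ω.1).IsDefeatistAnswer ω.1 ω.2 i) ∧
          ∀ i, (kdTree n₀ ω.1).IsDefeatistAnswer ω.1 ω.2 i →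
            dist (ω.1 i) ω.2 ≤ l1Dist (ω.1 i) ω.2 ∧
            l1Dist (ω.1 i) ω.2 ≤ leafCellDiam n₀ ω.1 ω.2) ∧
        -- the expected distance to the returned point, whatever the rule for breaking ties
        (∀ r : (Fin n → EuclideanSpace ℝ (Fin d)) × EuclideanSpace ℝ (Fin d) → Fin n,
          AEMeasurable r (sampleLaw n μ) →
          (∀ᵐ ω ∂(sampleLaw n μ),
            (kdTree n₀ ω.1).IsDefeatistAnswer ω.1 ω.2 (r ω)) →
          (Integrable (fun ω => l1Dist (ω.1 (r ω)) ω.2) (sampleLaw n μ) ∧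
            ∫ ω, l1Dist (ω.1 (r ω)) ω.2 ∂(sampleLaw n μ) ≤
              6 * (d : ℝ) * ((n₀ : ℝ) / (n : ℝ)) ^ (1 / (d : ℝ))) ∧
          (Integrable (fun ω => dist (ω.1 (r ω)) ω.2) (sampleLaw n μ) ∧
            ∫ ω, dist (ω.1 (r ω)) ω.2 ∂(sampleLaw n μ) ≤
              6 * (d : ℝ) * ((n₀ : ℝ) / (n : ℝ)) ^ (1 / (d : ℝ)))) := by
  -- A generous constant: the Chebyshev term needs `2 * 60 ^ 2 / n₀ ≤ 1 / 60`, that is `n₀ ≥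
  -- 432000`, and the frozen points need only `n₀ ≥ 60 * L`.
  refine ⟨10 ^ 6, by norm_num, fun d _ n n₀ L μ _ hac hcube hn₀ hL1 hn hlog => ?_⟩
  have hμ : ∀ (α : Fin d) (t : ℝ), μ {y | y α = t} = 0 := fun α t => hac (volume_hyperplane α t)
  have hL : 10 ^ 6 * L ≤ n₀ := by
    have h1 : (L : ℝ) ≤ Real.logb 2 n := by
      have hle : (2 : ℝ) ^ L ≤ n := by
        rw [hn]
        exact_mod_cast Nat.le_mul_of_pos_left _ hn₀
      rw [Real.le_logb_iff_rpow_le (by norm_num) (lt_of_lt_of_le (by positivity) hle),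
        Real.rpow_natCast]
      exact hle
    have h2 : (10 : ℝ) ^ 6 * L ≤ n₀ := le_trans (by gcongr) hlog
    exact_mod_cast h2
  have hdiam := integral_leafCellDiam_le hμ hcube hL1 hL hn
  have hsearch : ∀ᵐ ω ∂(sampleLaw n μ),
      (∃ i, (kdTree n₀ ω.1).IsDefeatistAnswer ω.1 ω.2 i) ∧
      ∀ i, (kdTree n₀ ω.1).IsDefeatistAnswer ω.1 ω.2 i →
        dist (ω.1 i) ω.2 ≤ l1Dist (ω.1 i) ω.2 ∧
        l1Dist (ω.1 i) ω.2 ≤ leafCellDiam n₀ ω.1 ω.2 := by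
    have hcube' : ∀ᵐ y ∂μ, y ∈ unitCube d := hcube
    have hx : ∀ᵐ ω ∂(sampleLaw n μ), ∀ i, ω.1 i ∈ unitCube d :=
      Measure.quasiMeasurePreserving_fst.ae <| ae_all_iff.2 fun i =>
        (measurePreserving_eval (fun _ : Fin n => μ) i).quasiMeasurePreserving.ae hcube'
    have hq : ∀ᵐ ω ∂(sampleLaw n μ), ω.2 ∈ unitCube d :=
      Measure.quasiMeasurePreserving_snd.ae hcube'
    have hne : (Finset.univ : Finset (Fin n)).Nonempty := by
      rw [← Finset.card_pos, Finset.card_fin, hn]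
      positivity
    filter_upwards [hx, hq] with ω hx hq
    refine ⟨exists_isDefeatistAnswer (leafPoints_nonempty n₀ ω.1 ω.2 _ 0 hne) ω.1,
      fun i hi => ⟨dist_le_l1Dist _ _, ?_⟩⟩
    exact l1Dist_le_l1Diam (leafCell_subset _ _ _)
      (mem_leafCell_of_mem_leafPoints n₀ ω.1 ω.2 _ 0 (fun i _ => hx i) hi.1)
      (mem_leafCell _ hq)
  refine ⟨hdiam, hsearch, fun r hr hans => ?_⟩
  have hxr : AEMeasurable (fun ω => ω.1 (r ω)) (sampleLaw n μ) :=
    ⟨fun ω => ω.1 (hr.mk r ω), measurable_eval_of_finite measurable_fst hr.measurable_mk,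
      hr.ae_eq_mk.mono fun ω h => by simp only [h]⟩
  have hl1 : AEStronglyMeasurable (fun ω => l1Dist (ω.1 (r ω)) ω.2) (sampleLaw n μ) := by
    unfold l1Dist
    refine (Finset.aemeasurable_fun_sum _ fun i _ => ?_).aestronglyMeasurable
    have h1 : AEMeasurable (fun ω => ω.1 (r ω) i) (sampleLaw n μ) :=
      (show Measurable fun y : EuclideanSpace ℝ (Fin d) => y i by fun_prop).comp_aemeasurable hxr
    have h2 : Measurable fun ω : (Fin n → EuclideanSpace ℝ (Fin d)) × EuclideanSpace ℝ (Fin d) =>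
        ω.2 i := by fun_prop
    exact (continuous_abs.measurable.comp_aemeasurable (h1.sub h2.aemeasurable))
  have hl1nn : ∀ x y : EuclideanSpace ℝ (Fin d), 0 ≤ l1Dist x y := fun x y =>
    Finset.sum_nonneg fun i _ => abs_nonneg _
  have hfirst := integrable_integral_le_of_le hdiam hl1 (fun ω => hl1nn _ _) <| by
    filter_upwards [hsearch, hans] with ω h1 h2
    exact (h1.2 _ h2).2
  exact ⟨hfirst, integrable_integral_le_of_le hfirst
    (hxr.dist measurable_snd.aemeasurable).aestronglyMeasurable (fun ω => dist_nonneg)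
    (ae_of_all _ fun ω => dist_le_l1Dist _ _)⟩
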